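/- Let $Z$ be a real $n\times r$ matrix with columns $z_1,\dots,z_r$ and let $P(Z)=\{Zy:\,-1\le y_i\le 1,\ 1\le i\le r\}\subset\mathbb R^n$ be the zonotope that it defines. Suppose that $P(Z)$ is an $n$-dimensional parallelotope, i.e. a full-dimensional convex polytope whose translates by the vectors of some set fill $\mathbb R^n$ facet to facet without common interior points. Let $\mathcal T$ be the set of translation vectors of $P(Z)$, i.e. of the vectors $t$ such that $\tfrac12 t$ is the center of a facet of $P(Z)$, and let $L(\mathcal T)$ be the additive group generated by $\mathcal T$. Call a set $X\subset\mathbb R^n$ unimodular if for every subset $B\subseteq X$ of $n$ linearly independent vectors each vector of $X$ is an integer linear combination of the vectors of $B$. Then there are $\beta_1,\dots,\beta_r>0$ such that $\{\beta_iz_i:1\le i\le r\}$ is unimodular. Moreover, for all $\beta_1,\dots,\beta_r>0$ such that $\{\beta_iz_i:1\le i\le r\}$ is unimodular, let $Z_\beta$ be the $n\times r$ matrix with columns $\sqrt{2\beta_i}\,z_i$, and put $Q=(Z_\beta Z_\beta^T)^{-1}$, $d_i=\beta_iQz_i$ and $D=\{d_i:1\le i\le r\}$. Then: 1. the matrix $Q$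 is well defined and positive definite, and $D$ is unimodular; 2. $L(\mathcal T)$ is a lattice of rank $n$ (a discrete subgroup that spans $\mathbb R^n$), and $L(\mathcal T)=L(D)$, where $L(D)$ is the set of intersection points of the hyperplanes $\{x:x^Td_i=k\}$, $1\le i\le r$, $k\in\mathbb Z$, that is, of the points $x$ such that some of these hyperplanes intersect exactly in $\{x\}$; 3. for all $x\in\mathbb R^n$, $\displaystyle x^TQx=\sum_{i=1}^r\frac{2}{\beta_i}\,(d_i^Tx)^2$. -/

import Mathlib

open Matrix

/-- `F` is a facet of the `n`-dimensional polytope `P` in `ℝⁿ`: a nonempty face cut out by a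
supporting hyperplane `pᵀ x = h`, of affine dimension `n - 1`. -/
def IsFacet {n : ℕ} (P F : Set (Fin n → ℝ)) : Prop :=
  ∃ (p : Fin n → ℝ) (h : ℝ), p ≠ 0 ∧ (∀ x ∈ P, p ⬝ᵥ x ≤ h) ∧ F = {x | x ∈ P ∧ p ⬝ᵥ x = h} ∧
    F.Nonempty ∧ Module.finrank ℝ (vectorSpan ℝ F) + 1 = n

/-- The translate `v + P`. -/
def translateBy {n : ℕ} (v : Fin n → ℝ) (P : Set (Fin n → ℝ)) : Set (Fin n → ℝ) :=
  (fun x => v + x) '' P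

/-- `P` is an `n`-dimensional parallelotope in `ℝⁿ`: a full-dimensional convex polytope whose
translates by the vectors of some set `V` fill the space, without common interior points and
facet to facet (every facet of a tile is also a facet of another tile). -/
def IsParallelotope {n : ℕ} (P : Set (Fin n → ℝ)) : Prop :=
  (∃ s : Finset (Fin n → ℝ), P = convexHull ℝ (s : Set (Fin n → ℝ))) ∧
  (interior P).Nonempty ∧
  ∃ V : Set (Fin n → ℝ),
    (⋃ v ∈ V, translateBy v P) = Set.univ ∧
    (∀ v ∈ V, ∀ w ∈ V, v ≠ w →
      Disjoint (interior (translateBy v P)) (interior (translateBy w P))) ∧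
    (∀ v ∈ V, ∀ F, IsFacet (translateBy v P) F →
      ∃ w ∈ V, w ≠ v ∧ IsFacet (translateBy w P) F)

/-- The zonotope `P(Z) = {Z y : -1 ≤ y_i ≤ 1}`, the Minkowski sum of the segments
`[-z_i, z_i]`, where `z_i` are the columns of `Z`. -/
def zonotope {n r : ℕ} (Z : Matrix (Fin n) (Fin r) ℝ) : Set (Fin n → ℝ) :=
  {x | ∃ y : Fin r → ℝ, (∀ i, -1 ≤ y i ∧ y i ≤ 1) ∧ x = Z *ᵥ y}

/-- `F` is centrally symmetric with center `c`. -/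
def IsCenter {n : ℕ} (c : Fin n → ℝ) (F : Set (Fin n → ℝ)) : Prop :=
  ∀ x ∈ F, (2 : ℝ) • c - x ∈ F

/-- The translation vectors of a parallelotope `P` centered at the origin: the vectors `t` such
that `t / 2` is the center of a facet of `P`. (Opposite facets give opposite vectors, so both
`t` and `-t` belong to this set.) -/
def translationVectors {n : ℕ} (P : Set (Fin n → ℝ)) : Set (Fin n → ℝ) :=
  {t | ∃ F, IsFacet P F ∧ IsCenter ((1 / 2 : ℝ) • t) F}

/-- The group `L(T)` generated by the translation vectors of `P`. -/
def translationLattice {n : ℕ} (P : Set (Fin n → ℝ)) : Submodule ℤ (Fin n → ℝ) :=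
  Submodule.span ℤ (translationVectors P)

/-- A set `X` of vectors of `ℝⁿ` is unimodular if, for every `n` independent vectors of `X`,
each vector of `X` is an integer linear combination of them. -/
def IsUnimodularSystem {n : ℕ} (X : Set (Fin n → ℝ)) : Prop :=
  ∀ B : Finset (Fin n → ℝ), (B : Set (Fin n → ℝ)) ⊆ X → B.card = n →
    LinearIndepOn ℝ id (B : Set (Fin n → ℝ)) →
    ∀ x ∈ X, x ∈ Submodule.span ℤ (B : Set (Fin n → ℝ))

/-- The hyperplane `H(d, m) = {x : xᵀ d = m}`. -/
def dicingHyperplane {n : ℕ} (d : Fin n → ℝ) (m : ℤ) : Set (Fin n → ℝ) :=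
  {x | x ⬝ᵥ d = (m : ℝ)}

/-- The family of all hyperplanes `H(d, m)`, `d ∈ D`, `m ∈ ℤ`. -/
def dicingFamily {n : ℕ} (D : Set (Fin n → ℝ)) : Set (Set (Fin n → ℝ)) :=
  {H | ∃ d ∈ D, ∃ m : ℤ, H = dicingHyperplane d m}

/-- `L(D)`: the set of intersection points of the hyperplanes `H(d, m)`, that is, of the points
that are the whole intersection of some hyperplanes of the family. -/
def dicingPoints {n : ℕ} (D : Set (Fin n → ℝ)) : Set (Fin n → ℝ) :=
  {x | ∃ S ⊆ dicingFamily D, ⋂₀ S = {x}}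

/-- The matrix `Z_β` with columns `√(2 β_i) z_i`. -/
noncomputable def scaledMatrix {n r : ℕ} (Z : Matrix (Fin n) (Fin r) ℝ) (β : Fin r → ℝ) :
    Matrix (Fin n) (Fin r) ℝ :=
  Matrix.of fun k i => Real.sqrt (2 * β i) * Z k i

/-- The matrix `Q = (Z_β Z_βᵀ)⁻¹` of the metric form. -/
noncomputable def metricMatrix {n r : ℕ} (Z : Matrix (Fin n) (Fin r) ℝ) (β : Fin r → ℝ) :
    Matrix (Fin n) (Fin n) ℝ :=
  (scaledMatrix Z β * (scaledMatrix Z β)ᵀ)⁻¹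

/-- The dicing vectors `d_i = β_i Q z_i`. -/
noncomputable def dicingVector {n r : ℕ} (Z : Matrix (Fin n) (Fin r) ℝ) (β : Fin r → ℝ)
    (i : Fin r) : Fin n → ℝ :=
  β i • (metricMatrix Z β *ᵥ Z.col i)

/-! The tiling enters through a single property of the columns. Let `p` and `q` be two facet
normals. If they never have opposite strict signs on a column, and agree in sign on a spanning set
of columns, then the difference of the two facet centers is an interior point of the zonotope. The
tiles adjacent across these facets then overlap, unless the centers coincide
(`faceCenter_eq_of_no_separation`). Taking `p` to be a coordinate function of a basis of columns and
`q` a suitable combination of two coordinate functions shows that every 2×2 minor with four nonzero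
entries, in coordinates of such a basis, vanishes (`IsParallelotope.hasBinaryMinors`).

This binary property yields the weights. They are built one vector at a time: within each connected
component of the support graph the normalized coordinates of the new vector have one absolute value,
so rescaling whole components absorbs them (`HasBinaryMinors.exists_weights`). Under a basis
exchange the vanishing minors keep the coordinates in `0, ±1` (`IsBalanced.exchange`), so one basis
suffices for all, and the scaled columns are unimodular.

For the second half, write `A` for `Z_β Z_βᵀ`, so `Q = A⁻¹` and `A p = ∑ 2 (p · β_i z_i) z_i`. By
unimodularity a facet normal `p` can be scaled so that all products `p · β_i z_i` are `0` or `±1`;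
then `A p` is exactly the translation vector of that facet (`dotProduct_eq_sign_of_facet`,
`mulVec_eq_two_smul_faceCenter`). Since `x · d_i = Q x · β_i z_i`, translation vectors have products
`0, ±1` with the `d_i`. Those of the facets dual to a basis of scaled columns form the basis dual to
the corresponding `d_i`, and this identifies the lattice with the dicing points
(`exists_basis_translationLattice`). The formula for the form is `p · A p` evaluated at `p = Q x`.
-/

/-! ### Exchanging one vector of a basis -/

section BasisExchange

variable {ι : Type*} [Fintype ι] [DecidableEq ι] {E : Type*} [AddCommGroup E] [Module ℝ E]

/-- The change of coordinates that belongs to exchanging the `j`-th basis vector for the vector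
with coordinates `a`. -/
noncomputable def exchangeEquiv (a : ι → ℝ) (j : ι) (ha : a j ≠ 0) : (ι → ℝ) ≃ₗ[ℝ] (ι → ℝ) where
  toFun v l := if l = j then v j / a j else v l - v j * a l / a j
  invFun v l := if l = j then v j * a j else v l + v j * a l
  map_add' v w := by
    ext l
    by_cases h : l = j <;> simp [h] <;> ring
  map_smul' t v := by
    ext l
    by_cases h : l = j <;> simp [h] <;> ring
  left_inv v := by
    ext l
    by_cases h : l = j
    · subst h; simp [ha]
    · simp [h]; ring
  right_inv v := by
    ext l
    by_cases h : l = j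
    · subst h; simp [ha]
    · simp [h]; field_simp; ring

theorem exists_basis_exchange (b : Module.Basis ι ℝ E) (j : ι) (c : E) (hc : b.repr c j ≠ 0) :
    ∃ b' : Module.Basis ι ℝ E, b' j = c ∧ (∀ l ≠ j, b' l = b l) ∧
      (∀ x, b'.repr x j = b.repr x j / b.repr c j) ∧
      ∀ x, ∀ l ≠ j, b'.repr x l = b.repr x l - b.repr x j * b.repr c l / b.repr c j := by
  set e := b.equivFun.trans (exchangeEquiv (b.repr c) j hc) with he
  have key : ∀ l y, e y = Pi.single l 1 → Module.Basis.ofEquivFun e l = y := by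
    intro l y h
    rw [Module.Basis.coe_ofEquivFun]
    dsimp only
    rw [← h, LinearEquiv.symm_apply_apply]
  refine ⟨Module.Basis.ofEquivFun e, key _ _ ?_, fun l hl => key _ _ ?_, fun x => ?_,
    fun x l hl => ?_⟩
  · ext m
    by_cases h : m = j
    · subst h; simp [he, exchangeEquiv, hc]
    · simp [he, exchangeEquiv, h, hc]
  · ext m
    by_cases h : m = j
    · subst h; simp [he, exchangeEquiv, Ne.symm hl]
    · simp only [he, exchangeEquiv, LinearEquiv.trans_apply, Module.Basis.equivFun_apply,
        Module.Basis.repr_self, LinearEquiv.coe_mk, LinearMap.coe_mk, AddHom.coe_mk, h, if_false,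
        Finsupp.single_apply, hl, zero_mul, zero_div, sub_zero, Pi.single_apply, eq_comm (a := l)]
  · simp [he, exchangeEquiv]
  · simp [he, exchangeEquiv, hl]

end BasisExchange

/-! ### Binary vector systems and balanced weights -/

section Binary

variable {ι : Type*} {E : Type*} [AddCommGroup E] [Module ℝ E]

/-- Two vectors of `X` with nonzero coordinates at two places of a basis from `X` have
proportional coordinates there. -/
def HasBinaryMinors (ι : Type*) {E : Type*} [AddCommGroup E] [Module ℝ E] (X : Set E) : Prop :=
  ∀ b : Module.Basis ι ℝ E, (∀ l, b l ∈ X) → ∀ j k, j ≠ k → ∀ z ∈ X, ∀ w ∈ X,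
    b.repr z j ≠ 0 → b.repr z k ≠ 0 → b.repr w j ≠ 0 → b.repr w k ≠ 0 →
    b.repr z j * b.repr w k = b.repr z k * b.repr w j

/-- With the weights `β`, the vectors of `X` have coordinates `0` and `±1` in the basis `b`. -/
def IsBalanced (β : E → ℝ) (X : Set E) (b : Module.Basis ι ℝ E) : Prop :=
  ∀ x ∈ X, ∀ j, b.repr x j ≠ 0 → β x * |b.repr x j| = β (b j)

theorem HasBinaryMinors.mono {X Y : Set E} (h : HasBinaryMinors ι Y) (hXY : X ⊆ Y) :
    HasBinaryMinors ι X :=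
  fun b hb j k hjk z hz w hw => h b (fun l => hXY (hb l)) j k hjk z (hXY hz) w (hXY hw)

theorem IsBalanced.reindex {β : E → ℝ} {X : Set E} {b : Module.Basis ι ℝ E}
    (h : IsBalanced β X b) (e : ι ≃ ι) : IsBalanced β X (b.reindex e) := by
  intro x hx j hj
  simp only [Module.Basis.repr_reindex_apply, Module.Basis.reindex_apply] at hj ⊢
  exact h x hx _ hj

/-- The pivot formula subtracts two terms. If both are nonzero, the vanishing minor makes them
cancel; otherwise at most one survives, and its weighted absolute value is already known. -/
theorem IsBalanced.exchange {β : E → ℝ} {X : Set E}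
    (hX : HasBinaryMinors ι X) {b b' : Module.Basis ι ℝ E} (h : IsBalanced β X b)
    (hb : ∀ l, b l ∈ X) {c : E} (hcX : c ∈ X) {j : ι} (hc : b.repr c j ≠ 0) (h1 : b' j = c)
    (h2 : ∀ l ≠ j, b' l = b l) (h3 : ∀ x, b'.repr x j = b.repr x j / b.repr c j)
    (h4 : ∀ x, ∀ l ≠ j, b'.repr x l = b.repr x l - b.repr x j * b.repr c l / b.repr c j) :
    IsBalanced β X b' := by
  intro x hx l hl
  have hcj := h c hcX j hc
  have hc0 : |b.repr c j| ≠ 0 := abs_ne_zero.2 hc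
  by_cases hlj : l = j
  · subst hlj
    rw [h3] at hl ⊢
    have hxl : b.repr x l ≠ 0 := fun h0 => hl (by simp [h0])
    have hxj := h x hx l hxl
    rw [h1, abs_div, ← mul_div_assoc, hxj, ← hcj, mul_div_cancel_right₀ _ hc0]
  · rw [h4 x l hlj] at hl ⊢
    rw [h2 l hlj]
    by_cases hxj : b.repr x j = 0
    · simp only [hxj, zero_mul, zero_div, sub_zero] at hl ⊢
      exact h x hx l hl
    by_cases hcl : b.repr c l = 0
    · simp only [hcl, mul_zero, zero_div, sub_zero] at hl ⊢
      exact h x hx l hl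
    by_cases hxl : b.repr x l = 0
    · have e1 := h x hx j hxj
      have e2 := h c hcX l hcl
      rw [hxl, zero_sub, abs_neg, abs_div, abs_mul, ← e2, ← mul_div_assoc, ← mul_assoc, e1, ← hcj]
      field_simp
    · refine absurd ?_ hl
      have := hX b hb l j hlj x hx c hcX hxl hxj hcl hc
      rw [← this, mul_div_cancel_right₀ _ hc, sub_self]

/-- Any two bases from `X` are joined by exchanges and permutations of the index set. The induction
is on the number of places where they differ. -/
theorem IsBalanced.of_basis [Fintype ι] {β : E → ℝ} {X : Set E}
    (hX : HasBinaryMinors ι X) (b' : Module.Basis ι ℝ E) (hb' : ∀ l, b' l ∈ X) :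
    ∀ b : Module.Basis ι ℝ E, IsBalanced β X b → (∀ l, b l ∈ X) → IsBalanced β X b' := by
  classical
  suffices H : ∀ (N : ℕ) (b : Module.Basis ι ℝ E), (Finset.univ.filter fun l => b l ≠ b' l).card = N →
      IsBalanced β X b → (∀ l, b l ∈ X) → IsBalanced β X b' from fun b => H _ b rfl
  intro N
  induction N using Nat.strong_induction_on with
  | _ N ih =>
  intro b hN h hb
  by_cases hall : ∀ l, b l = b' l
  · rwa [← Module.Basis.eq_of_apply_eq hall]
  push Not at hall
  obtain ⟨j, hj⟩ := hall
  -- If `b` and `b'` agreed on the support of `b' j`, then `b' j` would lie in the span of the other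
  -- vectors of `b'`.
  obtain ⟨l, hl, hbl⟩ : ∃ l, b.repr (b' j) l ≠ 0 ∧ b l ≠ b' l := by
    by_contra hcon
    push Not at hcon
    have hmem : b' j ∈ Submodule.span ℝ (b' '' {j}ᶜ) := by
      rw [← b.sum_repr (b' j)]
      refine Submodule.sum_mem _ fun l _ => ?_
      by_cases h0 : b.repr (b' j) l = 0
      · simp [h0]
      · refine Submodule.smul_mem _ _ (Submodule.subset_span ⟨l, ?_, (hcon l h0).symm⟩)
        rintro rfl
        exact hj (hcon l h0)
    exact b'.linearIndependent.notMem_span_image (s := {j}ᶜ) (x := j) (by simp) hmem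
  obtain ⟨b₁, h1, h2, h3, h4⟩ := exists_basis_exchange b l (b' j) hl
  have hbal := h.exchange hX hb (hb' j) hl h1 h2 h3 h4
  have hb₁ : ∀ m, b₁ m ∈ X := fun m => by
    by_cases hm : m = l
    · rw [hm, h1]; exact hb' j
    · rw [h2 m hm]; exact hb m
  -- The exchange puts `b' j` at place `l`; the swap moves it to place `j`. Place `j` becomes
  -- correct, and place `l` was already wrong, so the count drops.
  refine ih _ ?_ (b₁.reindex (Equiv.swap l j)) rfl (hbal.reindex _) fun m => by
    rw [Module.Basis.reindex_apply]; exact hb₁ _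
  rw [← hN]
  refine Finset.card_lt_card (Finset.ssubset_iff_of_subset ?_ |>.2
    ⟨j, Finset.mem_filter.2 ⟨Finset.mem_univ j, hj⟩, ?_⟩)
  · intro m hm
    simp only [Finset.mem_filter, Finset.mem_univ, true_and, Module.Basis.reindex_apply,
      Equiv.symm_swap] at hm ⊢
    by_cases hmj : m = j
    · rwa [hmj]
    by_cases hml : m = l
    · rwa [hml]
    rwa [Equiv.swap_apply_of_ne_of_ne hml hmj, h2 m hml] at hm
  · simp [h1]

/-! ### Connectivity of supports and the construction of weights -/

/-- `j` and `k` are joined by a path of length `m` of vectors of `S`, consecutive ones meeting in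
the supports of their coordinates. -/
def SupportPath (S : Set E) (b : Module.Basis ι ℝ E) : ℕ → ι → ι → Prop
  | 0, j, k => j = k
  | m + 1, j, k => ∃ c ∈ S, ∃ l, b.repr c j ≠ 0 ∧ b.repr c l ≠ 0 ∧ SupportPath S b m l k

theorem SupportPath.succ {S : Set E} {b : Module.Basis ι ℝ E} (hb : ∀ l, b l ∈ S) {m : ℕ} {j k : ι}
    (h : SupportPath S b m j k) : SupportPath S b (m + 1) j k :=
  ⟨b j, hb j, j, by simp, by simp, h⟩

theorem SupportPath.trans {S : Set E} {b : Module.Basis ι ℝ E} {m m' : ℕ} {j k l : ι}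
    (h : SupportPath S b m j k) (h' : SupportPath S b m' k l) :
    ∃ N, SupportPath S b N j l := by
  induction m generalizing j with
  | zero => obtain rfl : j = k := h; exact ⟨_, h'⟩
  | succ m ih =>
    obtain ⟨c, hc, i, h1, h2, h3⟩ := h
    obtain ⟨N, hN⟩ := ih h3
    exact ⟨N + 1, c, hc, i, h1, h2, hN⟩

theorem SupportPath.symm {S : Set E} {b : Module.Basis ι ℝ E} {m : ℕ} {j k : ι}
    (h : SupportPath S b m j k) : ∃ N, SupportPath S b N k j := by
  induction m generalizing j with
  | zero => obtain rfl : j = k := h; exact ⟨0, rfl⟩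
  | succ m ih =>
    obtain ⟨c, hc, i, h1, h2, h3⟩ := h
    obtain ⟨N, hN⟩ := ih h3
    exact hN.trans (m' := 1) ⟨c, hc, j, h2, h1, rfl⟩

/-- A path survives an exchange at a place that has no path of the same length. -/
theorem SupportPath.exchange {S : Set E} {b b' : Module.Basis ι ℝ E} (hb : ∀ l, b l ∈ S) {i : ι}
    (hsame : ∀ x, b.repr x i = 0 → b'.repr x = b.repr x) {m : ℕ} {j k : ι}
    (h : SupportPath S b m j k) (hi : ¬ SupportPath S b m i k) : SupportPath S b' m j k := by
  induction m generalizing j with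
  | zero => exact h
  | succ m ih =>
    obtain ⟨c, hc, l, h1, h2, h3⟩ := h
    have hci : b.repr c i = 0 := by
      by_contra hne
      exact hi ⟨c, hc, l, hne, h2, h3⟩
    exact ⟨c, hc, l, by rwa [hsame c hci], by rwa [hsame c hci], ih h3 fun h => hi (h.succ hb)⟩

/-- Along a path, a vector `z` has normalized coordinates of one absolute value. -/
theorem abs_repr_mul_eq_of_supportPath [Fintype ι] {β : E → ℝ} (hβ : ∀ x, 0 < β x) {S : Set E} {z : E}
    (hS : HasBinaryMinors ι (insert z S))
    (hbal : ∀ b : Module.Basis ι ℝ E, (∀ l, b l ∈ S) → IsBalanced β S b) (m : ℕ) :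
    ∀ (b : Module.Basis ι ℝ E), (∀ l, b l ∈ S) → ∀ j k, SupportPath S b m j k →
      b.repr z j ≠ 0 → b.repr z k ≠ 0 → |b.repr z j| * β (b k) = |b.repr z k| * β (b j) := by
  classical
  induction m with
  | zero => rintro b hb j k rfl _ _; rfl
  | succ m ih =>
    intro b hb j k hpath hzj hzk
    obtain ⟨c, hc, l, hcj, hcl, hl⟩ := hpath
    have ecj := hbal b hb c hc j hcj
    have direct : ∀ i, b.repr c i ≠ 0 → b.repr z i ≠ 0 →
        |b.repr z j| * β (b i) = |b.repr z i| * β (b j) := by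
      intro i hci hzi
      by_cases hij : i = j
      · rw [hij]
      have e1 := hbal b hb c hc i hci
      have e2 := hS b (fun l => Or.inr (hb l)) i j hij z (Or.inl rfl) c (Or.inr hc) hzi hzj hci hcj
      have e3 : |b.repr z i| * |b.repr c j| = |b.repr z j| * |b.repr c i| := by
        rw [← abs_mul, e2, abs_mul]
      rw [← e1, ← ecj]
      linear_combination (- β c) * e3
    by_cases hzl : b.repr z l = 0
    · by_cases hck : b.repr c k = 0
      -- The essential case: `z` vanishes at `l` and `c` at `k`. If no shorter path leads from `j`,
      -- exchanging `b j` for `c` makes `z` nonzero at `l`, fixes its coordinate at `k`, and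
      -- preserves the rest of the path; the induction hypothesis then applies in the new basis.
      · by_cases hjk : SupportPath S b m j k
        · exact ih b hb j k hjk hzj hzk
        have hlj : l ≠ j := by rintro rfl; exact hzj hzl
        have hkj : k ≠ j := by rintro rfl; exact hcj hck
        obtain ⟨b', h1, h2, h3, h4⟩ := exists_basis_exchange b j c hcj
        have hb' : ∀ i, b' i ∈ S := fun i => by
          by_cases hi : i = j
          · rw [hi, h1]; exact hc
          · rw [h2 i hi]; exact hb i
        have hsame : ∀ x, b.repr x j = 0 → b'.repr x = b.repr x := by
          intro x hx
          ext i
          by_cases hi : i = j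
          · rw [hi, h3, hx, zero_div]
          · rw [h4 x i hi, hx]; simp
        have ezk : b'.repr z k = b.repr z k := by rw [h4 z k hkj, hck]; simp
        have ezl : b'.repr z l = - (b.repr z j * b.repr c l / b.repr c j) := by
          rw [h4 z l hlj, hzl, zero_sub]
        have hzl' : b'.repr z l ≠ 0 := by
          rw [ezl]
          exact neg_ne_zero.2 (div_ne_zero (mul_ne_zero hzj hcl) hcj)
        have := ih b' hb' l k (hl.exchange hb hsame hjk) hzl' (by rwa [ezk])
        rw [ezl, ezk, h2 l hlj, h2 k hkj, abs_neg, abs_div, abs_mul, ← hbal b hb c hc l hcl] at this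
        have hcl0 : |b.repr c l| ≠ 0 := abs_ne_zero.2 hcl
        have hcj0 : |b.repr c j| ≠ 0 := abs_ne_zero.2 hcj
        rw [← ecj]
        field_simp at this
        linear_combination this
      · exact direct k hck hzk
    · have e1 := direct l hcl hzl
      have e2 := ih b hb l k hl hzl hzk
      have : β (b l) ≠ 0 := (hβ _).ne'
      apply mul_right_cancel₀ this
      linear_combination β (b k) * e1 + β (b j) * e2

/-- Vectors with the binary property can be scaled so that their coordinates in all bases from
among them are `0` and `±1`. -/
theorem HasBinaryMinors.exists_weights [Fintype ι] {X : Set E} (hfin : X.Finite) (hX : HasBinaryMinors ι X)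
    (b : Module.Basis ι ℝ E) (hb : ∀ l, b l ∈ X) :
    ∃ β : E → ℝ, (∀ x, 0 < β x) ∧ IsBalanced β X b := by
  classical
  suffices H : ∀ T : Finset E, (T : Set E) ⊆ X →
      ∃ β : E → ℝ, (∀ x, 0 < β x) ∧ IsBalanced β (Set.range b ∪ T) b by
    obtain ⟨β, h1, h2⟩ := H hfin.toFinset (by simp)
    exact ⟨β, h1, fun x hx => h2 x (Or.inr (by simpa using hx))⟩
  intro T
  induction T using Finset.induction_on with
  | empty =>
    intro _
    refine ⟨fun _ => 1, fun _ => one_pos, ?_⟩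
    rintro x hx j hj
    obtain ⟨l, rfl⟩ : x ∈ Set.range b := by simpa using hx
    rw [Module.Basis.repr_self, Finsupp.single_apply] at hj ⊢
    split_ifs at hj ⊢ with h
    · simp
    · simp at hj
  | insert z T _ ih =>
    intro hT
    obtain ⟨β, hβ, hbal⟩ := ih fun x hx => hT (by simp [Finset.mem_coe.1 hx])
    set S : Set E := Set.range b ∪ T with hSdef
    have hSz : Set.range b ∪ ((insert z T : Finset E) : Set E) = insert z S := by
      rw [Finset.coe_insert, Set.union_insert]
    rw [hSz]
    by_cases hz : z ∈ S
    · exact ⟨β, hβ, by rwa [Set.insert_eq_of_mem hz]⟩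
    have hbS : ∀ l, b l ∈ S := fun l => Or.inl ⟨l, rfl⟩
    have hSX : insert z S ⊆ X := by
      rw [← hSz]
      exact Set.union_subset (by rintro _ ⟨l, rfl⟩; exact hb l) hT
    have hbin : HasBinaryMinors ι (insert z S) := hX.mono hSX
    have hall : ∀ b' : Module.Basis ι ℝ E, (∀ l, b' l ∈ S) → IsBalanced β S b' :=
      fun b' hb' => IsBalanced.of_basis (hbin.mono (Set.subset_insert _ _)) b' hb' b hbal hbS
    have hmain := fun m => abs_repr_mul_eq_of_supportPath hβ hbin hall m b hbS
    -- `γ` is the common normalized absolute value of the coordinates of `z` on a component of the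
    -- support graph, and `1` on components that the support of `z` misses.
    have hγ : ∃ γ : ι → ℝ, (∀ j, 0 < γ j) ∧
        (∀ j, b.repr z j ≠ 0 → |b.repr z j| = β (b j) * γ j) ∧
        ∀ c ∈ S, ∀ j k, b.repr c j ≠ 0 → b.repr c k ≠ 0 → γ j = γ k := by
      let P : ι → ι → Prop := fun j k => (∃ m, SupportPath S b m j k) ∧ b.repr z k ≠ 0
      have hrel : ∀ j k k', P j k → P j k' →
          |b.repr z k| / β (b k) = |b.repr z k'| / β (b k') := by
        rintro j k k' ⟨⟨m, hm⟩, hk⟩ ⟨⟨m', hm'⟩, hk'⟩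
        obtain ⟨N, hN⟩ := hm.symm
        obtain ⟨N', hN'⟩ := hN.trans hm'
        rw [div_eq_div_iff (hβ _).ne' (hβ _).ne']
        exact hmain N' k k' hN' hk hk'
      refine ⟨fun j => if h : ∃ k, P j k then |b.repr z h.choose| / β (b h.choose) else 1,
        fun j => ?_, fun j hj => ?_, fun c hc j k hcj hck => ?_⟩
      · dsimp only
        split_ifs with h
        · exact div_pos (abs_pos.2 h.choose_spec.2) (hβ _)
        · exact one_pos
      · have hP : P j j := ⟨⟨0, rfl⟩, hj⟩
        have h : ∃ k, P j k := ⟨j, hP⟩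
        dsimp only
        rw [dif_pos h, hrel j _ j h.choose_spec hP, mul_div_cancel₀ _ (hβ _).ne']
      · have hPP : ∀ j k, b.repr c j ≠ 0 → b.repr c k ≠ 0 → ∀ l, P j l → P k l := by
          rintro j k hcj hck l ⟨⟨m, hm⟩, hl⟩
          exact ⟨⟨m + 1, c, hc, j, hck, hcj, hm⟩, hl⟩
        by_cases h : ∃ l, P j l
        · have h' : ∃ l, P k l := h.imp (hPP j k hcj hck)
          dsimp only
          rw [dif_pos h, dif_pos h']
          exact hrel k _ _ (hPP j k hcj hck _ h.choose_spec) h'.choose_spec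
        · have h' : ¬ ∃ l, P k l := fun h' => h (h'.imp (hPP k j hck hcj))
          dsimp only
          rw [dif_neg h, dif_neg h']
    obtain ⟨γ, hγ0, hγz, hγc⟩ := hγ
    -- The factor of the component containing the support of a vector of `S`. The value `1` is for
    -- the zero vector, whose weight only has to be positive.
    let g : E → ℝ := fun x => if h : ∃ j, b.repr x j ≠ 0 then γ h.choose else 1
    have hg0 : ∀ x, 0 < g x := fun x => by
      dsimp only [g]
      split_ifs
      · exact hγ0 _
      · exact one_pos
    have hg : ∀ c ∈ S, ∀ j, b.repr c j ≠ 0 → g c = γ j := by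
      intro c hc j hj
      have h : ∃ j, b.repr c j ≠ 0 := ⟨j, hj⟩
      dsimp only [g]
      rw [dif_pos h]
      exact hγc c hc _ _ h.choose_spec hj
    -- With `z` given weight `1`, balance asks that `b j` have weight `|b.repr z j|` on the support
    -- of `z`, which is `β (b j) * γ j`. Old vectors stay balanced because both sides gain the same
    -- factor.
    refine ⟨fun x => if x = z then 1 else β x * g x, fun x => ?_, ?_⟩
    · dsimp only
      split_ifs
      · exact one_pos
      · exact mul_pos (hβ x) (hg0 x)
    · have hbz : ∀ j, b j ≠ z := fun j h => hz (h ▸ hbS j)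
      have hgb : ∀ j, g (b j) = γ j := fun j => hg _ (hbS j) j (by simp)
      rintro x (rfl | hx) j hj
      · simp only [if_true, hbz, if_false, one_mul, hgb]
        exact hγz j hj
      · have hxz : x ≠ z := fun h => hz (h ▸ hx)
        simp only [hxz, hbz, if_false, hgb]
        rw [hg x hx j hj, ← hbal x hx j hj]
        ring

end Binary

/-! ### Faces, facets and facet centers of a zonotope -/

section Zonotope

variable {n r : ℕ} {Z : Matrix (Fin n) (Fin r) ℝ}

theorem mulVec_eq_sum_smul_col (y : Fin r → ℝ) : Z *ᵥ y = ∑ i, y i • Z.col i := by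
  ext k
  simp [Matrix.mulVec, dotProduct, Matrix.col, mul_comm]

theorem mem_zonotope_iff {x : Fin n → ℝ} :
    x ∈ zonotope Z ↔ ∃ y : Fin r → ℝ, (∀ i, |y i| ≤ 1) ∧ x = ∑ i, y i • Z.col i := by
  simp only [zonotope, Set.mem_ofPred_eq, mulVec_eq_sum_smul_col, abs_le]

/-- The maximum of `p` on the zonotope. -/
noncomputable def supportValue (Z : Matrix (Fin n) (Fin r) ℝ) (p : Fin n → ℝ) : ℝ :=
  ∑ i, |p ⬝ᵥ Z.col i|

/-- The center of the face of the zonotope in direction `p`. -/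
noncomputable def faceCenter (Z : Matrix (Fin n) (Fin r) ℝ) (p : Fin n → ℝ) : Fin n → ℝ :=
  ∑ i, (SignType.sign (p ⬝ᵥ Z.col i) : ℝ) • Z.col i

/-- The face of the zonotope in direction `p`. -/
def zonotopeFace (Z : Matrix (Fin n) (Fin r) ℝ) (p : Fin n → ℝ) : Set (Fin n → ℝ) :=
  {x | x ∈ zonotope Z ∧ p ⬝ᵥ x = supportValue Z p}

/-- The sum of the segments `[-z_i, z_i]` with `z_i` orthogonal to `p`. -/
def orthogonalZonotope (Z : Matrix (Fin n) (Fin r) ℝ) (p : Fin n → ℝ) : Set (Fin n → ℝ) :=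
  {x | ∃ y : Fin r → ℝ, (∀ i, |y i| ≤ 1) ∧ (∀ i, p ⬝ᵥ Z.col i ≠ 0 → y i = 0) ∧
    x = ∑ i, y i • Z.col i}

/-- The span of the columns orthogonal to `p`. -/
def orthogonalSpan (Z : Matrix (Fin n) (Fin r) ℝ) (p : Fin n → ℝ) : Submodule ℝ (Fin n → ℝ) :=
  Submodule.span ℝ (Z.col '' {i | p ⬝ᵥ Z.col i = 0})

theorem dotProduct_sum_smul_col (p : Fin n → ℝ) (y : Fin r → ℝ) :
    p ⬝ᵥ ∑ i, y i • Z.col i = ∑ i, y i * (p ⬝ᵥ Z.col i) := by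
  simp [dotProduct_sum, dotProduct_smul]

theorem abs_sign_le_one (a : ℝ) : |(SignType.sign a : ℝ)| ≤ 1 := by
  rcases lt_trichotomy a 0 with h | h | h <;> simp [h]

theorem sign_mul_self_eq_abs (a : ℝ) : (SignType.sign a : ℝ) * a = |a| := by
  simp

theorem mul_le_abs_of_abs_le_one {a t : ℝ} (ht : |t| ≤ 1) : t * a ≤ |a| := by
  calc t * a ≤ |t * a| := le_abs_self _
    _ = |t| * |a| := abs_mul _ _
    _ ≤ 1 * |a| := by gcongr
    _ = |a| := one_mul _

theorem eq_sign_of_mul_eq_abs {a t : ℝ} (ha : a ≠ 0) (h : t * a = |a|) :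
    t = (SignType.sign a : ℝ) := by
  rw [← sign_mul_self_eq_abs a] at h
  exact mul_right_cancel₀ ha h

theorem dotProduct_le_supportValue (p : Fin n → ℝ) {x : Fin n → ℝ} (hx : x ∈ zonotope Z) :
    p ⬝ᵥ x ≤ supportValue Z p := by
  obtain ⟨y, hy, rfl⟩ := mem_zonotope_iff.1 hx
  rw [dotProduct_sum_smul_col]
  exact Finset.sum_le_sum fun i _ => mul_le_abs_of_abs_le_one (hy i)

/-- Maximizing `p` maximizes each summand separately: the coefficient of a column not orthogonal to
`p` is forced to be the sign, and the remaining ones are free. -/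
theorem mem_zonotopeFace_iff {p x : Fin n → ℝ} :
    x ∈ zonotopeFace Z p ↔ ∃ s ∈ orthogonalZonotope Z p, x = faceCenter Z p + s := by
  constructor
  · rintro ⟨hx, hpx⟩
    obtain ⟨y, hy, rfl⟩ := mem_zonotope_iff.1 hx
    rw [dotProduct_sum_smul_col, supportValue,
      Finset.sum_eq_sum_iff_of_le fun i _ => mul_le_abs_of_abs_le_one (hy i)] at hpx
    refine ⟨_, ⟨fun i => y i - (SignType.sign (p ⬝ᵥ Z.col i) : ℝ), fun i => ?_, fun i hi => ?_,
      rfl⟩, ?_⟩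
    · by_cases hi : p ⬝ᵥ Z.col i = 0
      · simpa [hi] using hy i
      · simp only [eq_sign_of_mul_eq_abs hi (hpx i (Finset.mem_univ i)), sub_self, abs_zero]
        exact zero_le_one
    · simp only [eq_sign_of_mul_eq_abs hi (hpx i (Finset.mem_univ i)), sub_self]
    · rw [faceCenter, ← Finset.sum_add_distrib]
      refine Finset.sum_congr rfl fun i _ => ?_
      rw [← add_smul, add_sub_cancel]
  · rintro ⟨_, ⟨y, hy, hy0, rfl⟩, rfl⟩
    have hsum : faceCenter Z p + ∑ i, y i • Z.col i =
        ∑ i, ((SignType.sign (p ⬝ᵥ Z.col i) : ℝ) + y i) • Z.col i := by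
      simp only [faceCenter, add_smul, Finset.sum_add_distrib]
    rw [hsum]
    refine ⟨mem_zonotope_iff.2 ⟨_, fun i => ?_, rfl⟩, ?_⟩
    · by_cases hi : p ⬝ᵥ Z.col i = 0
      · simpa [hi] using hy i
      · rw [hy0 i hi, add_zero]
        exact abs_sign_le_one _
    · rw [dotProduct_sum_smul_col, supportValue]
      refine Finset.sum_congr rfl fun i _ => ?_
      by_cases hi : p ⬝ᵥ Z.col i = 0
      · simp [hi]
      · rw [hy0 i hi, add_zero, sign_mul_self_eq_abs]

theorem zero_mem_orthogonalZonotope (p : Fin n → ℝ) : 0 ∈ orthogonalZonotope Z p :=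
  ⟨0, by simp, by simp, by simp⟩

theorem neg_mem_orthogonalZonotope {p x : Fin n → ℝ} (hx : x ∈ orthogonalZonotope Z p) :
    -x ∈ orthogonalZonotope Z p := by
  obtain ⟨y, hy, hy0, rfl⟩ := hx
  exact ⟨-y, by simpa using hy, fun i hi => by simp [hy0 i hi], by simp⟩

theorem orthogonalZonotope_subset (p : Fin n → ℝ) : orthogonalZonotope Z p ⊆ zonotope Z := by
  rintro _ ⟨y, hy, -, rfl⟩
  exact mem_zonotope_iff.2 ⟨y, hy, rfl⟩

theorem faceCenter_mem_zonotopeFace (p : Fin n → ℝ) : faceCenter Z p ∈ zonotopeFace Z p :=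
  mem_zonotopeFace_iff.2 ⟨0, zero_mem_orthogonalZonotope p, by simp⟩

/-- A nonzero translation does not map `orthogonalZonotope Z p` into itself. -/
theorem eq_zero_of_add_mem_orthogonalZonotope {p s : Fin n → ℝ}
    (h : ∀ x ∈ orthogonalZonotope Z p, x + s ∈ orthogonalZonotope Z p) : s = 0 := by
  -- Iterating the translation from `0` puts every multiple of `s` into a set on which `s ⬝ᵥ ·` is
  -- bounded.
  have hk : ∀ k : ℕ, (k : ℝ) • s ∈ orthogonalZonotope Z p := by
    intro k
    induction k with
    | zero => simpa using zero_mem_orthogonalZonotope p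
    | succ k ih =>
      have := h _ ih
      rwa [Nat.cast_succ, add_smul, one_smul]
  by_contra hs
  have hpos : 0 < s ⬝ᵥ s := by
    refine lt_of_le_of_ne (Finset.sum_nonneg fun i _ => mul_self_nonneg _) fun h0 => hs ?_
    exact dotProduct_self_eq_zero.1 h0.symm
  obtain ⟨k, hk'⟩ := exists_nat_gt (supportValue Z s / (s ⬝ᵥ s))
  have := dotProduct_le_supportValue s (orthogonalZonotope_subset p (hk k))
  rw [dotProduct_smul, smul_eq_mul] at this
  rw [div_lt_iff₀ hpos] at hk'
  linarith

theorem vectorSpan_zonotopeFace (p : Fin n → ℝ) :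
    vectorSpan ℝ (zonotopeFace Z p) = orthogonalSpan Z p := by
  have hS : ∀ s ∈ orthogonalZonotope Z p, s ∈ orthogonalSpan Z p := by
    rintro _ ⟨y, hy, hy0, rfl⟩
    refine Submodule.sum_mem _ fun i _ => ?_
    by_cases hi : p ⬝ᵥ Z.col i = 0
    · exact Submodule.smul_mem _ _ (Submodule.subset_span ⟨i, hi, rfl⟩)
    · simp [hy0 i hi]
  apply le_antisymm
  · rw [vectorSpan, Submodule.span_le]
    rintro _ ⟨a, ha, b, hb, rfl⟩
    obtain ⟨s, hs, rfl⟩ := mem_zonotopeFace_iff.1 ha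
    obtain ⟨t, ht, rfl⟩ := mem_zonotopeFace_iff.1 hb
    simpa using sub_mem (hS s hs) (hS t ht)
  · rw [orthogonalSpan, Submodule.span_le]
    rintro _ ⟨i, hi, rfl⟩
    have hmem : Z.col i ∈ orthogonalZonotope Z p := by
      refine ⟨Pi.single i 1, fun j => ?_, fun j hj => ?_, ?_⟩
      · by_cases h : j = i
        · subst h; simp
        · simp [h]
      · have : j ≠ i := by rintro rfl; exact hj hi
        simp [this]
      · simp [Pi.single_apply]
    have := vsub_mem_vectorSpan ℝ (mem_zonotopeFace_iff.2 ⟨_, hmem, rfl⟩)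
      (faceCenter_mem_zonotopeFace (Z := Z) p)
    simpa using this

theorem isFacet_zonotope_iff {F : Set (Fin n → ℝ)} :
    IsFacet (zonotope Z) F ↔
      ∃ p, p ≠ 0 ∧ F = zonotopeFace Z p ∧ Module.finrank ℝ (orthogonalSpan Z p) + 1 = n := by
  constructor
  · rintro ⟨p, h, hp, hle, hF, ⟨x, hx⟩, hrank⟩
    have hh : h = supportValue Z p := by
      rw [hF] at hx
      refine le_antisymm (hx.2 ▸ dotProduct_le_supportValue p hx.1) ?_
      have := faceCenter_mem_zonotopeFace (Z := Z) p
      exact this.2 ▸ hle _ this.1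
    subst hh
    exact ⟨p, hp, hF, by rwa [← vectorSpan_zonotopeFace, zonotopeFace, ← hF]⟩
  · rintro ⟨p, hp, rfl, hrank⟩
    exact ⟨p, supportValue Z p, hp, fun x hx => dotProduct_le_supportValue p hx, rfl,
      ⟨_, faceCenter_mem_zonotopeFace p⟩, by rwa [vectorSpan_zonotopeFace]⟩

/-- Composing the reflections in two centers is a translation of the face into itself, which must be
trivial by boundedness. -/
theorem IsCenter.eq_faceCenter {p c : Fin n → ℝ} (h : IsCenter c (zonotopeFace Z p)) :
    c = faceCenter Z p := by
  have : (2 : ℝ) • (c - faceCenter Z p) = 0 := by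
    refine eq_zero_of_add_mem_orthogonalZonotope (p := p) (Z := Z) fun x hx => ?_
    obtain ⟨s, hs, hxs⟩ := mem_zonotopeFace_iff.1
      (h _ (mem_zonotopeFace_iff.2 ⟨_, neg_mem_orthogonalZonotope hx, rfl⟩))
    convert hs using 1
    rw [← sub_eq_iff_eq_add'] at hxs
    rw [← hxs]
    module
  simpa [sub_eq_zero] using this

theorem isCenter_faceCenter (p : Fin n → ℝ) : IsCenter (faceCenter Z p) (zonotopeFace Z p) := by
  intro x hx
  obtain ⟨s, hs, rfl⟩ := mem_zonotopeFace_iff.1 hx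
  exact mem_zonotopeFace_iff.2 ⟨-s, neg_mem_orthogonalZonotope hs, by module⟩

theorem mem_translationVectors_zonotope_iff {t : Fin n → ℝ} :
    t ∈ translationVectors (zonotope Z) ↔
      ∃ p, p ≠ 0 ∧ Module.finrank ℝ (orthogonalSpan Z p) + 1 = n ∧
        t = (2 : ℝ) • faceCenter Z p := by
  constructor
  · rintro ⟨F, hF, hc⟩
    obtain ⟨p, hp, rfl, hr⟩ := isFacet_zonotope_iff.1 hF
    refine ⟨p, hp, hr, ?_⟩
    rw [← hc.eq_faceCenter, smul_smul]
    norm_num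
  · rintro ⟨p, hp, hr, rfl⟩
    refine ⟨_, isFacet_zonotope_iff.2 ⟨p, hp, rfl, hr⟩, ?_⟩
    rw [smul_smul]
    norm_num
    exact isCenter_faceCenter p

/-! ### Translates and neighbours across facets -/

theorem translateBy_translateBy (v w : Fin n → ℝ) (P : Set (Fin n → ℝ)) :
    translateBy v (translateBy w P) = translateBy (v + w) P := by
  simp only [translateBy, Set.image_image, add_assoc]

theorem translateBy_zero (P : Set (Fin n → ℝ)) : translateBy 0 P = P := by
  simp [translateBy]

open scoped Pointwise in
theorem vectorSpan_translateBy (v : Fin n → ℝ) (F : Set (Fin n → ℝ)) :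
    vectorSpan ℝ (translateBy v F) = vectorSpan ℝ F :=
  vectorSpan_vadd ℝ F v

theorem IsFacet.translateBy {P F : Set (Fin n → ℝ)} (h : IsFacet P F) (v : Fin n → ℝ) :
    IsFacet (translateBy v P) (translateBy v F) := by
  obtain ⟨p, a, hp, hle, hF, hne, hrank⟩ := h
  refine ⟨p, a + p ⬝ᵥ v, hp, ?_, ?_, hne.image _, ?_⟩
  · rintro _ ⟨x, hx, rfl⟩
    have := hle x hx
    simp only [dotProduct_add]
    linarith
  · rw [hF]
    ext x
    constructor
    · rintro ⟨y, ⟨hy, hpy⟩, rfl⟩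
      exact ⟨⟨y, hy, rfl⟩, by simp only [dotProduct_add, hpy]; ring⟩
    · rintro ⟨⟨y, hy, rfl⟩, hpy⟩
      refine ⟨y, ⟨hy, ?_⟩, rfl⟩
      simp only [dotProduct_add] at hpy
      linarith
  · rwa [vectorSpan_translateBy]

theorem isFacet_translateBy_zonotope {w : Fin n → ℝ} {F : Set (Fin n → ℝ)}
    (h : IsFacet (translateBy w (zonotope Z)) F) :
    ∃ p, p ≠ 0 ∧ F = translateBy w (zonotopeFace Z p) ∧
      Module.finrank ℝ (orthogonalSpan Z p) + 1 = n := by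
  have h' := h.translateBy (-w)
  rw [translateBy_translateBy, neg_add_cancel, translateBy_zero, isFacet_zonotope_iff] at h'
  obtain ⟨p, hp, hF, hr⟩ := h'
  refine ⟨p, hp, ?_, hr⟩
  rw [← hF, translateBy_translateBy, add_neg_cancel, translateBy_zero]

theorem dotProduct_eq_zero_of_mem_orthogonalSpan {p x : Fin n → ℝ} (hx : x ∈ orthogonalSpan Z p) :
    p ⬝ᵥ x = 0 := by
  induction hx using Submodule.span_induction with
  | mem x hx => obtain ⟨i, hi, rfl⟩ := hx; exact hi
  | zero => simp
  | add x y _ _ hx hy => rw [dotProduct_add, hx, hy, add_zero]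
  | smul a x _ hx => rw [dotProduct_smul, hx, smul_zero]

theorem orthogonalSpan_lt_top {p : Fin n → ℝ} (hp : p ≠ 0) : orthogonalSpan Z p < ⊤ := by
  refine lt_top_iff_ne_top.2 fun h => hp ?_
  have : p ∈ orthogonalSpan Z p := h ▸ Submodule.mem_top
  exact dotProduct_self_eq_zero.1 (dotProduct_eq_zero_of_mem_orthogonalSpan this)

theorem mem_orthogonalSpan_of_dotProduct_eq_zero {p x : Fin n → ℝ} (hp : p ≠ 0)
    (hr : Module.finrank ℝ (orthogonalSpan Z p) + 1 = n) (hx : p ⬝ᵥ x = 0) :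
    x ∈ orthogonalSpan Z p := by
  by_contra hcon
  have h1 : orthogonalSpan Z p < orthogonalSpan Z p ⊔ Submodule.span ℝ {x} :=
    left_lt_sup.2 fun h => hcon (h (Submodule.mem_span_singleton_self x))
  have h2 := Submodule.finrank_lt_finrank_of_lt h1
  have h3 : orthogonalSpan Z p ⊔ Submodule.span ℝ {x} = ⊤ := by
    apply Submodule.eq_top_of_finrank_eq
    have := Submodule.finrank_le (orthogonalSpan Z p ⊔ Submodule.span ℝ {x})
    simp only [Module.finrank_fin_fun] at this ⊢
    omega
  have h4 : p ∈ orthogonalSpan Z p ⊔ Submodule.span ℝ {x} := h3 ▸ Submodule.mem_top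
  obtain ⟨y, hy, z, hz, hyz⟩ := Submodule.mem_sup.1 h4
  obtain ⟨a, rfl⟩ := Submodule.mem_span_singleton.1 hz
  refine hp (dotProduct_self_eq_zero.1 ?_)
  nth_rw 2 [← hyz]
  rw [dotProduct_add, dotProduct_eq_zero_of_mem_orthogonalSpan hy, dotProduct_smul, hx]
  simp

theorem finrank_orthogonalSpan_of_basis {p : Fin n → ℝ} (hp : p ≠ 0)
    (b : Module.Basis (Fin n) ℝ (Fin n → ℝ)) (hb : ∀ l, b l ∈ Set.range Z.col) (j : Fin n)
    (hj : ∀ l ≠ j, p ⬝ᵥ b l = 0) : Module.finrank ℝ (orthogonalSpan Z p) + 1 = n := by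
  have h1 := Submodule.finrank_lt (orthogonalSpan_lt_top (Z := Z) hp).ne
  have h2 : orthogonalSpan Z p ⊔ Submodule.span ℝ {b j} = ⊤ := by
    rw [eq_top_iff, ← b.span_eq, Submodule.span_le]
    rintro _ ⟨l, rfl⟩
    by_cases hl : l = j
    · exact Submodule.mem_sup_right (hl ▸ Submodule.mem_span_singleton_self _)
    · obtain ⟨i, hi⟩ := hb l
      exact Submodule.mem_sup_left (Submodule.subset_span ⟨i, by simp [hi, hj l hl], hi⟩)
  have h3 := Submodule.finrank_add_le_finrank_add_finrank (orthogonalSpan Z p)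
    (Submodule.span ℝ {b j})
  rw [h2, finrank_top, finrank_span_singleton (b.ne_zero j)] at h3
  simp only [Module.finrank_fin_fun] at h1 h3
  omega

theorem faceCenter_smul (μ : ℝ) (p : Fin n → ℝ) :
    faceCenter Z (μ • p) = (SignType.sign μ : ℝ) • faceCenter Z p := by
  simp only [faceCenter, smul_dotProduct, smul_eq_mul, sign_mul, Finset.smul_sum, smul_smul,
    SignType.coe_mul]

theorem orthogonalZonotope_smul {μ : ℝ} (hμ : μ ≠ 0) (p : Fin n → ℝ) :
    orthogonalZonotope Z (μ • p) = orthogonalZonotope Z p := by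
  simp [orthogonalZonotope, smul_dotProduct, hμ]

theorem eq_of_translateBy_zonotopeFace_eq {v w p q : Fin n → ℝ}
    (hS : orthogonalZonotope Z q = orthogonalZonotope Z p)
    (h : translateBy v (zonotopeFace Z p) = translateBy w (zonotopeFace Z q)) :
    v + faceCenter Z p = w + faceCenter Z q := by
  rw [← sub_eq_zero]
  refine eq_zero_of_add_mem_orthogonalZonotope (p := p) (Z := Z) fun x hx => ?_
  have : v + (faceCenter Z p + x) ∈ translateBy w (zonotopeFace Z q) :=
    h ▸ ⟨_, mem_zonotopeFace_iff.2 ⟨x, hx, rfl⟩, rfl⟩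
  obtain ⟨y, hy, hyx⟩ := this
  obtain ⟨s, hs, rfl⟩ := mem_zonotopeFace_iff.1 hy
  rw [← hS]
  convert hs using 1
  have hyx' : w + (faceCenter Z q + s) = v + (faceCenter Z p + x) := hyx
  rw [← sub_eq_zero] at hyx' ⊢
  rw [← neg_eq_zero, ← hyx']
  module

/-- In a facet-to-facet tiling the neighbour of a tile across a facet is its translate by twice
the center of the facet. -/
theorem add_two_smul_faceCenter_mem {V : Set (Fin n → ℝ)}
    (hV : ∀ v ∈ V, ∀ F, IsFacet (translateBy v (zonotope Z)) F →
      ∃ w ∈ V, w ≠ v ∧ IsFacet (translateBy w (zonotope Z)) F)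
    {v p : Fin n → ℝ} (hv : v ∈ V) (hp : p ≠ 0)
    (hr : Module.finrank ℝ (orthogonalSpan Z p) + 1 = n) :
    v + (2 : ℝ) • faceCenter Z p ∈ V := by
  obtain ⟨w, hw, hwv, hF⟩ := hV v hv _
    ((isFacet_zonotope_iff.2 ⟨p, hp, rfl, hr⟩).translateBy v)
  obtain ⟨q, hq, hFq, hrq⟩ := isFacet_translateBy_zonotope hF
  have hspan : orthogonalSpan Z p = orthogonalSpan Z q := by
    have h1 := congrArg (vectorSpan ℝ) hFq
    rwa [vectorSpan_translateBy, vectorSpan_translateBy, vectorSpan_zonotopeFace, vectorSpan_zonotopeFace] at h1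
  have hpp : p ⬝ᵥ p ≠ 0 := fun h => hp (dotProduct_self_eq_zero.1 h)
  -- Both normals are orthogonal to the same hyperplane, the direction of the common facet.
  obtain ⟨μ, rfl⟩ : ∃ μ : ℝ, q = μ • p := by
    refine ⟨(p ⬝ᵥ q) / (p ⬝ᵥ p), ?_⟩
    have h0 : p ⬝ᵥ (q - ((p ⬝ᵥ q) / (p ⬝ᵥ p)) • p) = 0 := by
      rw [dotProduct_sub, dotProduct_smul, smul_eq_mul, div_mul_cancel₀ _ hpp, sub_self]
    have h1 := dotProduct_eq_zero_of_mem_orthogonalSpan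
      (hspan ▸ mem_orthogonalSpan_of_dotProduct_eq_zero hp hr h0)
    rw [← sub_eq_zero, ← dotProduct_self_eq_zero, sub_dotProduct, smul_dotProduct, h0, h1]
    simp
  have hμ : μ ≠ 0 := by rintro rfl; simp at hq
  have hc := eq_of_translateBy_zonotopeFace_eq (orthogonalZonotope_smul hμ p) hFq
  rw [faceCenter_smul] at hc
  -- For `μ < 0` the tiles lie on opposite sides and comparing centers gives `w`; for `μ > 0` the
  -- comparison gives `w = v`, which is excluded.
  rcases lt_or_gt_of_ne hμ with h | h
  · convert hw using 1
    rw [sign_neg h, SignType.coe_neg_one, ← sub_eq_zero] at hc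
    rw [← sub_eq_zero, ← hc]
    module
  · rw [sign_pos h, SignType.coe_one, one_smul] at hc
    exact absurd (add_right_cancel hc).symm hwv

/-! ### Overlapping tiles and the binary property -/

theorem span_range_col_eq_top (h : (interior (zonotope Z)).Nonempty) :
    Submodule.span ℝ (Set.range Z.col) = ⊤ := by
  have hsub : zonotope Z ⊆ (Submodule.span ℝ (Set.range Z.col) : Set (Fin n → ℝ)) := by
    intro x hx
    obtain ⟨y, -, rfl⟩ := mem_zonotope_iff.1 hx
    exact Submodule.sum_mem _ fun i _ => Submodule.smul_mem _ _ (Submodule.subset_span ⟨i, rfl⟩)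
  exact Submodule.eq_top_of_nonempty_interior' _ (h.mono (interior_mono hsub))

/-- A point of the zonotope is interior if the columns with coefficient zero span the space. -/
theorem sum_smul_col_mem_interior {y : Fin r → ℝ} (hy : ∀ i, |y i| ≤ 1)
    (hspan : Submodule.span ℝ (Z.col '' {i | y i = 0}) = ⊤) :
    ∑ i, y i • Z.col i ∈ interior (zonotope Z) := by
  classical
  -- Only the coefficients that vanish in `y` are varied. Their columns span, so `f` is open and the
  -- image of the open cube is a neighbourhood of `0`.
  let f : (Fin r → ℝ) →ₗ[ℝ] (Fin n → ℝ) :=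
    ∑ i, (LinearMap.proj i : (Fin r → ℝ) →ₗ[ℝ] ℝ).smulRight (if y i = 0 then Z.col i else 0)
  have hf : ∀ u, f u = ∑ i, u i • (if y i = 0 then Z.col i else 0) := by
    intro u
    simp [f]
  have hsurj : Function.Surjective f := by
    rw [← LinearMap.range_eq_top, eq_top_iff, ← hspan, Submodule.span_le]
    rintro _ ⟨i, hi, rfl⟩
    refine ⟨Pi.single i 1, ?_⟩
    have hi' : y i = 0 := hi
    rw [hf, Finset.sum_eq_single i]
    · simp [hi']
    · intro j _ hj
      simp [hj]
    · simp
  have hopen := f.isOpenMap_of_finiteDimensional hsurj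
  have hbox : IsOpen (Set.univ.pi fun _ : Fin r => Set.Ioo (-1 : ℝ) 1) :=
    isOpen_set_pi Set.finite_univ fun _ _ => isOpen_Ioo
  have himg := (isOpenMap_add_left (∑ i, y i • Z.col i)) _ (hopen _ hbox)
  refine mem_interior.2 ⟨_, ?_, himg, ⟨0, ⟨0, by simp, by simp⟩, by simp⟩⟩
  rintro _ ⟨_, ⟨u, hu, rfl⟩, rfl⟩
  refine mem_zonotope_iff.2 ⟨fun i => if y i = 0 then u i else y i, fun i => ?_, ?_⟩
  · dsimp only
    split_ifs
    · have := hu i (Set.mem_univ i)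
      exact abs_le.2 ⟨this.1.le, this.2.le⟩
    · exact hy i
  · dsimp only
    rw [hf, ← Finset.sum_add_distrib]
    refine Finset.sum_congr rfl fun i _ => ?_
    split_ifs with h <;> simp [h]

theorem interior_translateBy (v : Fin n → ℝ) (P : Set (Fin n → ℝ)) :
    interior (translateBy v P) = translateBy v (interior P) :=
  ((Homeomorph.addLeft v).image_interior P).symm

theorem exists_dotProduct_eq_repr (b : Module.Basis (Fin n) ℝ (Fin n → ℝ)) (j : Fin n) :
    ∃ p : Fin n → ℝ, ∀ x, p ⬝ᵥ x = b.repr x j := by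
  refine ⟨fun i => b.repr (fun j => if i = j then 1 else 0) j, fun x => ?_⟩
  have := (b.coord j).pi_apply_eq_sum_univ x
  rw [Module.Basis.coord_apply] at this
  rw [this, dotProduct]
  exact Finset.sum_congr rfl fun i _ => by rw [smul_eq_mul, mul_comm, Module.Basis.coord_apply]

/-- If two facet normals do not separate a column and the columns that they treat alike span the
space, then the difference of the facet vectors is twice an interior point, which is impossible in
a tiling. -/
theorem faceCenter_eq_of_no_separation {V : Set (Fin n → ℝ)} (hne : V.Nonempty)
    (hdisj : ∀ v ∈ V, ∀ w ∈ V, v ≠ w →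
      Disjoint (interior (translateBy v (zonotope Z))) (interior (translateBy w (zonotope Z))))
    (hV : ∀ v ∈ V, ∀ F, IsFacet (translateBy v (zonotope Z)) F →
      ∃ w ∈ V, w ≠ v ∧ IsFacet (translateBy w (zonotope Z)) F)
    {p q : Fin n → ℝ} (hp : p ≠ 0) (hq : q ≠ 0)
    (hrp : Module.finrank ℝ (orthogonalSpan Z p) + 1 = n)
    (hrq : Module.finrank ℝ (orthogonalSpan Z q) + 1 = n)
    (hpq : ∀ i, 0 ≤ (p ⬝ᵥ Z.col i) * (q ⬝ᵥ Z.col i))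
    (hspan : Submodule.span ℝ (Z.col '' {i | SignType.sign (p ⬝ᵥ Z.col i) =
      SignType.sign (q ⬝ᵥ Z.col i)}) = ⊤) :
    faceCenter Z p = faceCenter Z q := by
  let y : Fin r → ℝ := fun i =>
    (SignType.sign (p ⬝ᵥ Z.col i) : ℝ) - (SignType.sign (q ⬝ᵥ Z.col i) : ℝ)
  have hy : ∀ i, |y i| ≤ 1 := by
    intro i
    have := hpq i
    dsimp only [y]
    rcases lt_trichotomy (p ⬝ᵥ Z.col i) 0 with h | h | h <;>
      rcases lt_trichotomy (q ⬝ᵥ Z.col i) 0 with h' | h' | h' <;> simp [h, h']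
    · exact absurd (mul_neg_of_neg_of_pos h h') (not_lt.2 this)
    · exact absurd (mul_neg_of_pos_of_neg h h') (not_lt.2 this)
  have hy0 : {i | y i = 0} = {i | SignType.sign (p ⬝ᵥ Z.col i) =
      SignType.sign (q ⬝ᵥ Z.col i)} := by
    ext i
    simp only [y, Set.mem_ofPred_eq, sub_eq_zero]
    constructor
    · intro h
      cases h1 : SignType.sign (p ⬝ᵥ Z.col i) <;> cases h2 : SignType.sign (q ⬝ᵥ Z.col i) <;>
        first | rfl | (rw [h1, h2] at h; norm_num at h)
    · intro h
      rw [h]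
  have hc : ∑ i, y i • Z.col i = faceCenter Z p - faceCenter Z q := by
    simp only [y, sub_smul, Finset.sum_sub_distrib, faceCenter]
  have hint := sum_smul_col_mem_interior hy (hy0 ▸ hspan)
  have hint' : ∑ i, (-y) i • Z.col i ∈ interior (zonotope Z) :=
    sum_smul_col_mem_interior (by simpa using hy) (by
      simp only [Pi.neg_apply, neg_eq_zero]; rw [hy0]; exact hspan)
  obtain ⟨v, hv⟩ := hne
  have h1 := add_two_smul_faceCenter_mem hV hv hp hrp
  have h2 := add_two_smul_faceCenter_mem hV hv hq hrq
  by_contra hneq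
  have hdis := hdisj _ h1 _ h2 fun h =>
    hneq (smul_right_injective _ (two_ne_zero (α := ℝ)) (add_left_cancel h))
  -- The midpoint of the two tile centers differs from each of them by `±(faceCenter Z p -
  -- faceCenter Z q)`, an interior point of the zonotope.
  have hmem₁ : v + faceCenter Z p + faceCenter Z q ∈
      interior (translateBy (v + (2 : ℝ) • faceCenter Z p) (zonotope Z)) := by
    rw [interior_translateBy]
    refine ⟨_, hint', ?_⟩
    simp only [Pi.neg_apply, neg_smul, Finset.sum_neg_distrib, hc]
    module
  have hmem₂ : v + faceCenter Z p + faceCenter Z q ∈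
      interior (translateBy (v + (2 : ℝ) • faceCenter Z q) (zonotope Z)) := by
    rw [interior_translateBy]
    refine ⟨_, hint, ?_⟩
    simp only [hc]
    module
  exact Set.disjoint_left.1 hdis hmem₁ hmem₂

/-- Tilt the facet normal `p` (coordinate `j`) towards `q` (coordinate `k`) until a column first
becomes orthogonal. A nonvanishing minor leaves enough columns with unchanged signs for the two
facet centers to coincide, yet `b k` is orthogonal to `p` and not to the tilted normal. -/
theorem IsParallelotope.hasBinaryMinors (h : IsParallelotope (zonotope Z)) :
    HasBinaryMinors (Fin n) (Set.range Z.col) := by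
  obtain ⟨-, -, V, hcover, hdisj, hV⟩ := h
  have hne : V.Nonempty := by
    have : (0 : Fin n → ℝ) ∈ ⋃ v ∈ V, translateBy v (zonotope Z) := hcover ▸ Set.mem_univ _
    simp only [Set.mem_iUnion] at this
    obtain ⟨v, hv, -⟩ := this
    exact ⟨v, hv⟩
  intro b hb j k hjk z hz w hw hzj hzk hwj hwk
  obtain ⟨p, hp⟩ := exists_dotProduct_eq_repr b j
  obtain ⟨q, hq⟩ := exists_dotProduct_eq_repr b k
  obtain ⟨iz, hiz⟩ := hz
  let C : Finset (Fin r) := Finset.univ.filter fun i =>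
    p ⬝ᵥ Z.col i ≠ 0 ∧ q ⬝ᵥ Z.col i ≠ 0
  have hC : C.Nonempty := ⟨iz, by simp [C, hp, hq, hiz, hzj, hzk]⟩
  obtain ⟨m, hmC, hmin⟩ := C.exists_min_image
    (fun i => |p ⬝ᵥ Z.col i| / |q ⬝ᵥ Z.col i|) hC
  simp only [C, Finset.mem_filter, Finset.mem_univ, true_and] at hmC hmin
  obtain ⟨hmp, hmq⟩ := hmC
  -- This makes column `m` orthogonal to `p + t • q`. Minimality of the ratio at `m` gives `|t| |q ·
  -- z_i| ≤ |p · z_i|` wherever both products are nonzero, so no sign is reversed.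
  set t : ℝ := - (p ⬝ᵥ Z.col m) / (q ⬝ᵥ Z.col m) with ht
  have ht0 : t ≠ 0 := div_ne_zero (neg_ne_zero.2 hmp) hmq
  have hts : ∀ x, (p + t • q) ⬝ᵥ x = b.repr x j + t * b.repr x k := by
    intro x
    rw [add_dotProduct, smul_dotProduct, hp, hq, smul_eq_mul]
  have hpb : ∀ l, p ⬝ᵥ b l = if l = j then 1 else 0 := fun l => by
    rw [hp, Module.Basis.repr_self, Finsupp.single_apply]
  have hqb : ∀ l, q ⬝ᵥ b l = if l = k then 1 else 0 := fun l => by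
    rw [hq, Module.Basis.repr_self, Finsupp.single_apply]
  have htb : ∀ l, (p + t • q) ⬝ᵥ b l = (if l = j then 1 else 0) + t * (if l = k then 1 else 0) := by
    intro l
    rw [add_dotProduct, smul_dotProduct, hpb, hqb, smul_eq_mul]
  have htm : (p + t • q) ⬝ᵥ Z.col m = 0 := by
    rw [add_dotProduct, smul_dotProduct, smul_eq_mul, ht]
    field_simp
    ring
  have hp0 : p ≠ 0 := by
    rintro rfl
    exact hmp (by simp)
  have hpt0 : p + t • q ≠ 0 := by
    intro h
    have := htb j
    rw [h] at this
    simp [hjk] at this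
  have hrp := finrank_orthogonalSpan_of_basis hp0 b hb j fun l hl => by simp [hpb, hl]
  obtain ⟨b₁, h1, h2, -, -⟩ := exists_basis_exchange b k (Z.col m) (by rwa [← hq])
  have hrpt : Module.finrank ℝ (orthogonalSpan Z (p + t • q)) + 1 = n := by
    refine finrank_orthogonalSpan_of_basis hpt0 b₁ (fun l => ?_) j fun l hl => ?_
    · by_cases hlk : l = k
      · exact ⟨m, by rw [hlk, h1]⟩
      · rw [h2 l hlk]; exact hb l
    · by_cases hlk : l = k
      · rw [hlk, h1, htm]
      · rw [h2 l hlk, htb]; simp [hl, hlk]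
  have hsep : ∀ i, 0 ≤ (p ⬝ᵥ Z.col i) * ((p + t • q) ⬝ᵥ Z.col i) := by
    intro i
    by_cases hpi : p ⬝ᵥ Z.col i = 0
    · simp [hpi]
    by_cases hqi : q ⬝ᵥ Z.col i = 0
    · rw [add_dotProduct, smul_dotProduct, hqi, smul_zero, add_zero]
      exact mul_self_nonneg _
    have h3 := hmin i ⟨hpi, hqi⟩
    have h4 : |t| * |q ⬝ᵥ Z.col i| ≤ |p ⬝ᵥ Z.col i| := by
      rw [ht, abs_div, abs_neg]
      exact (le_div_iff₀ (abs_pos.2 hqi)).1 h3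
    rw [add_dotProduct, smul_dotProduct, smul_eq_mul, mul_add]
    have h5 : |p ⬝ᵥ Z.col i * (t * q ⬝ᵥ Z.col i)| ≤ p ⬝ᵥ Z.col i * p ⬝ᵥ Z.col i := by
      rw [abs_mul, abs_mul, ← abs_mul_abs_self (p ⬝ᵥ Z.col i)]
      exact mul_le_mul_of_nonneg_left h4 (abs_nonneg _)
    have := neg_abs_le (p ⬝ᵥ Z.col i * (t * q ⬝ᵥ Z.col i))
    linarith
  by_contra hcon
  -- If `p + t • q` vanished on both `z` and `w`, their coordinates at `j` and `k` would be
  -- proportional. The vector `u` replaces `b k`, the one basis vector on which the signs differ.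
  obtain ⟨u, huX, huj, huk, hu⟩ : ∃ u ∈ Set.range Z.col, b.repr u j ≠ 0 ∧ b.repr u k ≠ 0 ∧
      (p + t • q) ⬝ᵥ u ≠ 0 := by
    by_contra hall
    push Not at hall
    have e1 := hall z ⟨iz, hiz⟩ hzj hzk
    have e2 := hall w hw hwj hwk
    rw [hts] at e1 e2
    exact hcon (by linear_combination b.repr w k * e1 - b.repr z k * e2)
  obtain ⟨b₂, h3, h4, -, -⟩ := exists_basis_exchange b k u huk
  have hspan : Submodule.span ℝ (Z.col '' {i | SignType.sign (p ⬝ᵥ Z.col i) =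
      SignType.sign ((p + t • q) ⬝ᵥ Z.col i)}) = ⊤ := by
    rw [eq_top_iff, ← b₂.span_eq, Submodule.span_le]
    rintro _ ⟨l, rfl⟩
    by_cases hl : l = k
    · obtain ⟨i, rfl⟩ := huX
      rw [hl, h3]
      refine Submodule.subset_span ⟨i, ?_, rfl⟩
      have hs := hsep i
      rw [← hp] at huj
      have hs' := lt_of_le_of_ne hs (mul_ne_zero huj hu).symm
      rcases mul_pos_iff.1 hs' with ⟨ha, hb⟩ | ⟨ha, hb⟩
      · exact (sign_pos ha).trans (sign_pos hb).symm
      · exact (sign_neg ha).trans (sign_neg hb).symm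
    · obtain ⟨i, hi⟩ := hb l
      rw [h4 l hl]
      refine Submodule.subset_span ⟨i, ?_, hi⟩
      rw [Set.mem_ofPred_eq, hi, htb, hpb]
      simp [hl]
  have heq := faceCenter_eq_of_no_separation hne hdisj hV hp0 hpt0 hrp hrpt hsep hspan
  -- on `p + t q` the face center of `p` falls short of the maximum, because `b k` is missed
  have hmax := (faceCenter_mem_zonotopeFace (Z := Z) (p + t • q)).2
  rw [← heq, faceCenter, dotProduct_sum_smul_col, supportValue,
    Finset.sum_eq_sum_iff_of_le fun i _ => mul_le_abs_of_abs_le_one (abs_sign_le_one _)] at hmax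
  obtain ⟨i, hi⟩ := hb k
  have := hmax i (Finset.mem_univ i)
  rw [hi, htb, hpb] at this
  simp only [hjk.symm, if_false, sign_zero, SignType.coe_zero, zero_mul, zero_add, if_true,
    mul_one] at this
  exact ht0 (abs_eq_zero.1 this.symm)

end Zonotope

/-! ### Unimodular systems, dicing points and normalized facet normals -/

section Unimodular

variable {n r : ℕ} {Z : Matrix (Fin n) (Fin r) ℝ}

theorem exists_basis_of_span_eq_top {X : Set (Fin n → ℝ)} (h : Submodule.span ℝ X = ⊤) :
    ∃ b : Module.Basis (Fin n) ℝ (Fin n → ℝ), ∀ l, b l ∈ X := by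
  let b := Module.Basis.ofSpan h.ge
  have := FiniteDimensional.fintypeBasisIndex b
  refine ⟨b.reindex (Fintype.equivFinOfCardEq ?_), fun l => ?_⟩
  · rw [← Module.finrank_eq_card_basis b, Module.finrank_fin_fun]
  · rw [Module.Basis.reindex_apply]
    exact Module.Basis.ofSpan_subset h.ge ⟨_, rfl⟩

theorem isUnimodularSystem_iff {X : Set (Fin n → ℝ)} :
    IsUnimodularSystem X ↔ ∀ b : Module.Basis (Fin n) ℝ (Fin n → ℝ), (∀ l, b l ∈ X) →
      ∀ x ∈ X, ∀ l, ∃ m : ℤ, b.repr x l = m := by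
  classical
  constructor
  · intro h b hb x hx l
    have hcoe : ((Finset.univ.image b : Finset (Fin n → ℝ)) : Set (Fin n → ℝ)) = Set.range b := by
      simp
    have hmem := h (Finset.univ.image b) (by rw [hcoe]; rintro _ ⟨l, rfl⟩; exact hb l)
      (by rw [Finset.card_image_of_injective _ b.injective, Finset.card_univ, Fintype.card_fin])
      (by rw [hcoe]; exact b.linearIndependent.linearIndepOn_id) x hx
    rw [hcoe, b.mem_span_iff_repr_mem ℤ] at hmem
    obtain ⟨m, hm⟩ := hmem l
    exact ⟨m, by simpa using hm.symm⟩
  · intro h B hBX hcard hli x hx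
    let e := Finset.equivFinOfCardEq hcard
    have hli' : LinearIndependent ℝ fun l => ((e.symm l : B) : Fin n → ℝ) :=
      LinearIndependent.comp hli e.symm e.symm.injective
    let b := Module.Basis.mk hli' (hli'.span_eq_top_of_card_eq_finrank' (by simp)).ge
    have hb : ∀ l, b l = ((e.symm l : B) : Fin n → ℝ) := fun l => Module.Basis.mk_apply _ _ l
    have hmem : x ∈ Submodule.span ℤ (Set.range b) := by
      rw [b.mem_span_iff_repr_mem ℤ]
      intro l
      obtain ⟨m, hm⟩ := h b (fun l => by rw [hb]; exact hBX (e.symm l).2) x hx l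
      exact ⟨m, by simpa using hm.symm⟩
    refine Submodule.span_mono ?_ hmem
    rintro _ ⟨l, rfl⟩
    rw [hb]
    exact (e.symm l).2

theorem IsUnimodularSystem.image {X : Set (Fin n → ℝ)} (h : IsUnimodularSystem X)
    (e : (Fin n → ℝ) ≃ₗ[ℝ] (Fin n → ℝ)) : IsUnimodularSystem (e '' X) := by
  rw [isUnimodularSystem_iff] at h ⊢
  rintro b hb _ ⟨x, hx, rfl⟩ l
  obtain ⟨m, hm⟩ := h (b.map e.symm) (fun l => by
    obtain ⟨y, hy, hye⟩ := hb l
    rw [Module.Basis.map_apply, ← hye, e.symm_apply_apply]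
    exact hy) x hx l
  exact ⟨m, by simpa using hm⟩

theorem exists_isUnimodularSystem_of_hasBinaryMinors
    (hspan : Submodule.span ℝ (Set.range Z.col) = ⊤)
    (hbin : HasBinaryMinors (Fin n) (Set.range Z.col)) :
    ∃ β : Fin r → ℝ, (∀ i, 0 < β i) ∧ IsUnimodularSystem (Set.range fun i => β i • Z.col i) := by
  obtain ⟨b₀, hb₀⟩ := exists_basis_of_span_eq_top hspan
  obtain ⟨β, hβ, hbal⟩ := hbin.exists_weights (Set.finite_range _) b₀ hb₀
  refine ⟨fun i => β (Z.col i), fun i => hβ _, isUnimodularSystem_iff.2 ?_⟩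
  rintro b hb _ ⟨i, rfl⟩ l
  choose f hf using hb
  have hunit : ∀ l, IsUnit ((β (Z.col (f l)))⁻¹) := fun l =>
    (isUnit_iff_ne_zero.2 (inv_ne_zero (hβ _).ne'))
  let b₁ := b.isUnitSMul hunit
  have hb₁ : ∀ l, b₁ l = Z.col (f l) := by
    intro l
    rw [Module.Basis.isUnitSMul_apply, ← hf l]
    dsimp only
    rw [smul_smul, inv_mul_cancel₀ (hβ _).ne', one_smul]
  have hrepr : ∀ x, b.repr x l = (β (Z.col (f l)))⁻¹ * b₁.repr x l := by
    intro x
    rw [Module.Basis.repr_isUnitSMul, Units.smul_def, Units.val_inv_eq_inv_val, IsUnit.unit_spec,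
      inv_inv, smul_eq_mul, inv_mul_cancel_left₀ (hβ _).ne']
  -- Balance is transported to the unscaled basis `b₁`; after scaling, it says that the coordinates
  -- are `0` or `±1`.
  have hbal₁ := IsBalanced.of_basis hbin b₁ (fun l => ⟨f l, (hb₁ l).symm⟩) b₀ hbal hb₀
  dsimp only
  rw [hrepr, map_smul, Finsupp.smul_apply, smul_eq_mul]
  by_cases h0 : b₁.repr (Z.col i) l = 0
  · exact ⟨0, by simp [h0]⟩
  have h1 := hbal₁ _ ⟨i, rfl⟩ l h0
  rw [hb₁] at h1
  have hne := (hβ (Z.col (f l))).ne'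
  rcases abs_choice (b₁.repr (Z.col i) l) with h2 | h2 <;> rw [h2] at h1
  · exact ⟨1, by rw [h1, inv_mul_cancel₀ hne, Int.cast_one]⟩
  · refine ⟨-1, ?_⟩
    rw [mul_neg, neg_eq_iff_eq_neg] at h1
    rw [h1, mul_neg, inv_mul_cancel₀ hne, Int.cast_neg, Int.cast_one]

/-- The points of the dicing are the points with integer products with all vectors of `D`. -/
theorem dicingPoints_eq {D : Set (Fin n → ℝ)} (hD : IsUnimodularSystem D)
    (hspan : Submodule.span ℝ D = ⊤) :
    dicingPoints D = {x | ∀ d ∈ D, ∃ m : ℤ, x ⬝ᵥ d = m} := by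
  ext x
  constructor
  · rintro ⟨S, hS, hx⟩
    have hxS : ∀ H ∈ S, x ∈ H := fun H hH => by
      have : x ∈ ⋂₀ S := hx ▸ Set.mem_singleton x
      exact this H hH
    let Y : Set (Fin n → ℝ) := {d | d ∈ D ∧ ∃ m : ℤ, dicingHyperplane d m ∈ S}
    -- Otherwise a nonzero `u` is orthogonal to all normals in use, and `x + u` lies in the same
    -- hyperplanes as `x`.
    have hY : Submodule.span ℝ Y = ⊤ := by
      by_contra hne
      obtain ⟨f, hf0, hf⟩ := Submodule.exists_le_ker_of_lt_top _ (lt_top_iff_ne_top.2 hne)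
      let u : Fin n → ℝ := fun i => f fun j => if i = j then 1 else 0
      have hfu : ∀ d, f d = u ⬝ᵥ d := fun d => by
        rw [f.pi_apply_eq_sum_univ d, dotProduct]
        exact Finset.sum_congr rfl fun i _ => by rw [smul_eq_mul, mul_comm]
      have hmem : x + u ∈ ⋂₀ S := by
        intro H hH
        obtain ⟨d, hd, m, rfl⟩ := hS hH
        have h1 : x ⬝ᵥ d = m := hxS _ hH
        have h2 : f d = 0 := hf (Submodule.subset_span ⟨hd, m, hH⟩)
        change (x + u) ⬝ᵥ d = m
        rw [add_dotProduct, h1, ← hfu, h2, add_zero]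
      rw [hx, Set.mem_singleton_iff, add_eq_left] at hmem
      exact hf0 (LinearMap.ext fun d => by rw [hfu, hmem]; simp)
    obtain ⟨b, hb⟩ := exists_basis_of_span_eq_top hY
    intro d hd
    have hint : ∀ l, ∃ m : ℤ, x ⬝ᵥ b l = m := fun l => by
      obtain ⟨m, hm⟩ := (hb l).2
      exact ⟨m, hxS _ hm⟩
    choose m hm using hint
    choose k hk using isUnimodularSystem_iff.1 hD b (fun l => (hb l).1) d hd
    refine ⟨∑ l, k l * m l, ?_⟩
    rw [← b.sum_repr d, dotProduct_sum]
    push_cast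
    exact Finset.sum_congr rfl fun l _ => by rw [dotProduct_smul, hk, hm, smul_eq_mul]
  · intro hx
    refine ⟨{H | ∃ d ∈ D, ∃ m : ℤ, H = dicingHyperplane d m ∧ x ∈ H}, ?_, ?_⟩
    · rintro _ ⟨d, hd, m, rfl, -⟩
      exact ⟨d, hd, m, rfl⟩
    · refine Set.eq_singleton_iff_unique_mem.2 ⟨?_, fun y hy => ?_⟩
      · rintro _ ⟨d, hd, m, rfl, h⟩
        exact h
      · have hzero : ∀ d ∈ Submodule.span ℝ D, (y - x) ⬝ᵥ d = 0 := by
          intro d hd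
          induction hd using Submodule.span_induction with
          | mem d hd =>
            obtain ⟨m, hm⟩ := hx d hd
            have : y ⬝ᵥ d = m := hy _ ⟨d, hd, m, rfl, hm⟩
            rw [sub_dotProduct, this, hm, sub_self]
          | zero => simp
          | add a b _ _ ha hb => rw [dotProduct_add, ha, hb, add_zero]
          | smul a b _ hb => rw [dotProduct_smul, hb, smul_zero]
        rw [← sub_eq_zero]
        exact dotProduct_self_eq_zero.1 (hzero _ (hspan ▸ Submodule.mem_top))

/-- A facet normal with product `1` with one of the scaled columns has products `0` and `±1` with
all of them. -/
theorem dotProduct_eq_sign_of_facet {β : Fin r → ℝ} (hβ : ∀ i, 0 < β i)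
    (hX : IsUnimodularSystem (Set.range fun i => β i • Z.col i)) {p : Fin n → ℝ} (hp : p ≠ 0)
    (hr : Module.finrank ℝ (orthogonalSpan Z p) + 1 = n) {i₀ : Fin r}
    (h₀ : p ⬝ᵥ (β i₀ • Z.col i₀) = 1) (i : Fin r) :
    p ⬝ᵥ (β i • Z.col i) = (SignType.sign (p ⬝ᵥ Z.col i) : ℝ) := by
  have key : ∀ i j, p ⬝ᵥ (β i • Z.col i) ≠ 0 →
      ∃ m : ℤ, p ⬝ᵥ (β j • Z.col j) = m * p ⬝ᵥ (β i • Z.col i) := by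
    intro i j hi
    -- A basis drawn from `Y` has products with `p` equal to `0` or to that of column `i`, so
    -- integer coordinates in it give divisibility.
    let Y : Set (Fin n → ℝ) := insert (β i • Z.col i)
      ((fun i => β i • Z.col i) '' {i | p ⬝ᵥ Z.col i = 0})
    have hY : Submodule.span ℝ Y = ⊤ := by
      have hle : orthogonalSpan Z p ≤ Submodule.span ℝ Y := by
        rw [orthogonalSpan, Submodule.span_le]
        rintro _ ⟨k, hk, rfl⟩
        have : (β k)⁻¹ • (β k • Z.col k) ∈ Submodule.span ℝ Y :=
          Submodule.smul_mem _ _ (Submodule.subset_span (Or.inr ⟨k, hk, rfl⟩))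
        rwa [smul_smul, inv_mul_cancel₀ (hβ k).ne', one_smul] at this
      rw [eq_top_iff]
      intro x _
      set a := p ⬝ᵥ x / p ⬝ᵥ (β i • Z.col i) with ha
      have h1 : x - a • (β i • Z.col i) ∈ orthogonalSpan Z p := by
        refine mem_orthogonalSpan_of_dotProduct_eq_zero hp hr ?_
        rw [dotProduct_sub, dotProduct_smul, smul_eq_mul, ha, div_mul_cancel₀ _ hi, sub_self]
      have h2 : a • (β i • Z.col i) ∈ Submodule.span ℝ Y :=
        Submodule.smul_mem _ _ (Submodule.subset_span (Or.inl rfl))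
      simpa using add_mem (hle h1) h2
    obtain ⟨b, hb⟩ := exists_basis_of_span_eq_top hY
    choose m hm using isUnimodularSystem_iff.1 hX b (fun l => by
      rcases hb l with h | ⟨k, -, h⟩
      · exact ⟨i, h.symm⟩
      · exact ⟨k, h⟩) _ ⟨j, rfl⟩
    have hpb : ∀ l, ∃ k : ℤ, p ⬝ᵥ b l = k * p ⬝ᵥ (β i • Z.col i) := by
      intro l
      rcases hb l with h | ⟨k, hk, h⟩
      · exact ⟨1, by rw [h]; simp⟩
      · have hk' : p ⬝ᵥ Z.col k = 0 := hk
        exact ⟨0, by rw [← h]; simp [hk']⟩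
    choose k hk using hpb
    refine ⟨∑ l, m l * k l, ?_⟩
    nth_rw 1 [← b.sum_repr (β j • Z.col j)]
    rw [dotProduct_sum]
    push_cast
    rw [Finset.sum_mul]
    exact Finset.sum_congr rfl fun l _ => by
      rw [dotProduct_smul, smul_eq_mul, hk, ← mul_assoc, ← hm]
  have hs : SignType.sign (p ⬝ᵥ Z.col i) = SignType.sign (p ⬝ᵥ (β i • Z.col i)) := by
    rw [dotProduct_smul, smul_eq_mul, sign_mul, sign_pos (hβ i), one_mul]
  rw [hs]
  by_cases hi : p ⬝ᵥ (β i • Z.col i) = 0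
  · simp [hi]
  obtain ⟨m, hm⟩ := key i₀ i (by rw [h₀]; exact one_ne_zero)
  obtain ⟨k, hk⟩ := key i i₀ hi
  rw [h₀, mul_one] at hm
  rw [h₀, hm] at hk
  -- Divisibility in both directions between columns `i` and `i₀` leaves only `±1`.
  have hkm : k * m = 1 := by exact_mod_cast hk.symm
  rcases Int.eq_one_or_neg_one_of_mul_eq_one' hkm with ⟨-, h⟩ | ⟨-, h⟩ <;> rw [hm, h] <;> simp

end Unimodular

/-! ### The metric form and the translation lattice -/

section MetricForm

variable {n r : ℕ} {Z : Matrix (Fin n) (Fin r) ℝ} {β : Fin r → ℝ}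

theorem scaledMatrix_mul_transpose_mulVec (hβ : ∀ i, 0 < β i) (p : Fin n → ℝ) :
    (scaledMatrix Z β * (scaledMatrix Z β)ᵀ) *ᵥ p =
      ∑ i, (2 * (p ⬝ᵥ (β i • Z.col i))) • Z.col i := by
  rw [← mulVec_mulVec, mulVec_eq_sum_smul_col]
  refine Finset.sum_congr rfl fun i _ => ?_
  have hcol : (scaledMatrix Z β).col i = √(2 * β i) • Z.col i := by
    ext k
    simp [scaledMatrix, Matrix.col]
  have hdot : ((scaledMatrix Z β)ᵀ *ᵥ p) i = (scaledMatrix Z β).col i ⬝ᵥ p := rfl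
  rw [hdot, hcol, smul_smul, smul_dotProduct, smul_eq_mul, mul_right_comm,
    Real.mul_self_sqrt (mul_pos two_pos (hβ i)).le, dotProduct_smul, smul_eq_mul,
    dotProduct_comm p, mul_assoc]

theorem dotProduct_scaledMatrix_mul_transpose_mulVec (hβ : ∀ i, 0 < β i) (p : Fin n → ℝ) :
    p ⬝ᵥ ((scaledMatrix Z β * (scaledMatrix Z β)ᵀ) *ᵥ p) =
      ∑ i, (2 / β i) * (p ⬝ᵥ (β i • Z.col i)) ^ 2 := by
  rw [scaledMatrix_mul_transpose_mulVec hβ, dotProduct_sum_smul_col]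
  refine Finset.sum_congr rfl fun i _ => ?_
  have := (hβ i).ne'
  rw [dotProduct_smul, smul_eq_mul]
  field_simp

theorem posDef_scaledMatrix_mul_transpose (hβ : ∀ i, 0 < β i)
    (hspan : Submodule.span ℝ (Set.range Z.col) = ⊤) :
    (scaledMatrix Z β * (scaledMatrix Z β)ᵀ).PosDef := by
  rw [Matrix.posDef_iff_dotProduct_mulVec]
  refine ⟨by simp [Matrix.IsHermitian, conjTranspose_eq_transpose_of_trivial], fun x hx => ?_⟩
  rw [star_trivial, dotProduct_scaledMatrix_mul_transpose_mulVec hβ]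
  have hnonneg : ∀ i ∈ Finset.univ, 0 ≤ (2 / β i) * (x ⬝ᵥ (β i • Z.col i)) ^ 2 := fun i _ =>
    mul_nonneg (div_pos two_pos (hβ i)).le (sq_nonneg _)
  refine lt_of_le_of_ne (Finset.sum_nonneg hnonneg) fun h => hx ?_
  rw [eq_comm, Finset.sum_eq_zero_iff_of_nonneg hnonneg] at h
  have hzero : Submodule.span ℝ (Set.range Z.col) ≤ orthogonalSpan Z x := by
    rw [Submodule.span_le]
    rintro _ ⟨i, rfl⟩
    refine Submodule.subset_span ⟨i, ?_, rfl⟩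
    have := h i (Finset.mem_univ i)
    simpa [(hβ i).ne', dotProduct_smul] using this
  have hmem : x ∈ orthogonalSpan Z x := hzero (hspan ▸ Submodule.mem_top)
  exact dotProduct_self_eq_zero.1 (dotProduct_eq_zero_of_mem_orthogonalSpan hmem)

theorem metricMatrix_mulVec_mulVec (hβ : ∀ i, 0 < β i)
    (hspan : Submodule.span ℝ (Set.range Z.col) = ⊤) (x : Fin n → ℝ) :
    metricMatrix Z β *ᵥ ((scaledMatrix Z β * (scaledMatrix Z β)ᵀ) *ᵥ x) = x := by
  rw [metricMatrix, mulVec_mulVec, Matrix.nonsing_inv_mul _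
    (posDef_scaledMatrix_mul_transpose hβ hspan).det_pos.ne'.isUnit, one_mulVec]

theorem mulVec_metricMatrix_mulVec (hβ : ∀ i, 0 < β i)
    (hspan : Submodule.span ℝ (Set.range Z.col) = ⊤) (x : Fin n → ℝ) :
    (scaledMatrix Z β * (scaledMatrix Z β)ᵀ) *ᵥ (metricMatrix Z β *ᵥ x) = x := by
  rw [metricMatrix, mulVec_mulVec, Matrix.mul_nonsing_inv _
    (posDef_scaledMatrix_mul_transpose hβ hspan).det_pos.ne'.isUnit, one_mulVec]

/-- Symmetry of `Q` turns products with dicing vectors into products of `Q x` with the scaled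
columns, where unimodularity applies. -/
theorem dotProduct_dicingVector (x : Fin n → ℝ) (i : Fin r) :
    x ⬝ᵥ dicingVector Z β i = (metricMatrix Z β *ᵥ x) ⬝ᵥ (β i • Z.col i) := by
  have hsymm : (metricMatrix Z β)ᵀ = metricMatrix Z β := by
    rw [metricMatrix, Matrix.transpose_nonsing_inv, transpose_mul, transpose_transpose]
  rw [dicingVector, dotProduct_smul, dotProduct_smul, dotProduct_mulVec, ← mulVec_transpose, hsymm]

/-- The linear automorphism with matrix `Q`. -/
noncomputable def metricEquiv (hβ : ∀ i, 0 < β i)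
    (hspan : Submodule.span ℝ (Set.range Z.col) = ⊤) : (Fin n → ℝ) ≃ₗ[ℝ] (Fin n → ℝ) :=
  LinearEquiv.ofLinearMap (metricMatrix Z β).mulVecLin
    (scaledMatrix Z β * (scaledMatrix Z β)ᵀ).mulVecLin
    (LinearMap.ext fun x => metricMatrix_mulVec_mulVec hβ hspan x)
    (LinearMap.ext fun x => mulVec_metricMatrix_mulVec hβ hspan x)

theorem range_dicingVector (hβ : ∀ i, 0 < β i)
    (hspan : Submodule.span ℝ (Set.range Z.col) = ⊤) :
    Set.range (dicingVector Z β) =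
      metricEquiv hβ hspan '' Set.range fun i => β i • Z.col i := by
  rw [← Set.range_comp]
  refine congrArg Set.range (funext fun i => ?_)
  change _ = metricMatrix Z β *ᵥ (β i • Z.col i)
  rw [dicingVector, mulVec_smul]

theorem span_range_smul_col (hβ : ∀ i, 0 < β i)
    (hspan : Submodule.span ℝ (Set.range Z.col) = ⊤) :
    Submodule.span ℝ (Set.range fun i => β i • Z.col i) = ⊤ := by
  rw [eq_top_iff, ← hspan, Submodule.span_le]
  rintro _ ⟨i, rfl⟩
  have : (β i)⁻¹ • (β i • Z.col i) ∈ Submodule.span ℝ (Set.range fun i => β i • Z.col i) :=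
    Submodule.smul_mem _ _ (Submodule.subset_span ⟨i, rfl⟩)
  rwa [smul_smul, inv_mul_cancel₀ (hβ i).ne', one_smul] at this

theorem span_range_dicingVector (hβ : ∀ i, 0 < β i)
    (hspan : Submodule.span ℝ (Set.range Z.col) = ⊤) :
    Submodule.span ℝ (Set.range (dicingVector Z β)) = ⊤ := by
  rw [range_dicingVector hβ hspan]
  have := Submodule.map_span (metricEquiv hβ hspan).toLinearMap
    (Set.range fun i => β i • Z.col i)
  rw [span_range_smul_col hβ hspan, Submodule.map_top, LinearEquiv.range] at this
  exact this.symm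

/-- A normalized facet normal gives a facet vector. -/
theorem mulVec_eq_two_smul_faceCenter (hβ : ∀ i, 0 < β i) {p : Fin n → ℝ}
    (h : ∀ i, p ⬝ᵥ (β i • Z.col i) = (SignType.sign (p ⬝ᵥ Z.col i) : ℝ)) :
    (scaledMatrix Z β * (scaledMatrix Z β)ᵀ) *ᵥ p = (2 : ℝ) • faceCenter Z p := by
  rw [scaledMatrix_mul_transpose_mulVec hβ, faceCenter, Finset.smul_sum]
  exact Finset.sum_congr rfl fun i _ => by rw [h, smul_smul]

/-- The translation lattice is generated by a basis of the space, in which the coordinates of `x`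
are its products with dicing vectors. -/
theorem exists_basis_translationLattice (hβ : ∀ i, 0 < β i)
    (hspan : Submodule.span ℝ (Set.range Z.col) = ⊤)
    (hX : IsUnimodularSystem (Set.range fun i => β i • Z.col i)) :
    ∃ t : Module.Basis (Fin n) ℝ (Fin n → ℝ),
      translationLattice (zonotope Z) = Submodule.span ℤ (Set.range t) ∧
      ∀ x, x ∈ Submodule.span ℤ (Set.range t) ↔
        ∀ d ∈ Set.range (dicingVector Z β), ∃ m : ℤ, x ⬝ᵥ d = m := by
  obtain ⟨b, hb⟩ := exists_basis_of_span_eq_top (span_range_smul_col hβ hspan)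
  choose f hf using hb
  -- the basis that is dual to the vectors `Q b_j`
  let g : (Fin n → ℝ) →ₗ[ℝ] (Fin n → ℝ) :=
    LinearMap.pi fun j => (dotProductBilin ℝ ℝ (b j)).comp (metricMatrix Z β).mulVecLin
  have hg : ∀ x j, g x j = b j ⬝ᵥ (metricMatrix Z β *ᵥ x) := fun x j => rfl
  have hginj : Function.Injective g := by
    rw [← LinearMap.ker_eq_bot, LinearMap.ker_eq_bot']
    intro x hx
    have h1 : ∀ y, y ⬝ᵥ (metricMatrix Z β *ᵥ x) = 0 := by
      intro y
      rw [← b.sum_repr y, sum_dotProduct]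
      refine Finset.sum_eq_zero fun j _ => ?_
      rw [smul_dotProduct, ← hg, hx]
      simp
    have h2 := dotProduct_self_eq_zero.1 (h1 (metricMatrix Z β *ᵥ x))
    rw [← mulVec_metricMatrix_mulVec hβ hspan x, h2, mulVec_zero]
  let t := Module.Basis.ofEquivFun (LinearEquiv.ofInjectiveEndo g hginj)
  have ht : ∀ x j, t.repr x j = b j ⬝ᵥ (metricMatrix Z β *ᵥ x) := fun x j => by
    rw [Module.Basis.ofEquivFun_repr_apply]
    rfl
  have hmem : ∀ x, x ∈ Submodule.span ℤ (Set.range t) ↔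
      ∀ j, ∃ m : ℤ, b j ⬝ᵥ (metricMatrix Z β *ᵥ x) = m := by
    intro x
    rw [t.mem_span_iff_repr_mem ℤ]
    refine forall_congr' fun j => ?_
    rw [ht]
    simp [eq_comm]
  refine ⟨t, le_antisymm ?_ ?_, fun x => ?_⟩
  · rw [translationLattice, Submodule.span_le]
    intro s hs
    obtain ⟨p, hp, hr, rfl⟩ := mem_translationVectors_zonotope_iff.1 hs
    obtain ⟨i, hi⟩ : ∃ i, p ⬝ᵥ (β i • Z.col i) ≠ 0 := by
      by_contra hall
      push Not at hall
      refine (orthogonalSpan_lt_top (Z := Z) hp).ne (eq_top_iff.2 ?_)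
      rw [← hspan, Submodule.span_le]
      rintro _ ⟨i, rfl⟩
      refine Submodule.subset_span ⟨i, ?_, rfl⟩
      have := hall i
      rwa [dotProduct_smul, smul_eq_mul, mul_eq_zero, or_iff_right (hβ i).ne'] at this
    -- Normalizes the facet normal. `μ` may be negative, which replaces the facet by its opposite
    -- and only changes the sign of the translation vector.
    set μ : ℝ := (p ⬝ᵥ (β i • Z.col i))⁻¹ with hμ
    have hμ0 : μ ≠ 0 := inv_ne_zero hi
    have hq0 : μ • p ≠ 0 := smul_ne_zero hμ0 hp
    have hrq : Module.finrank ℝ (orthogonalSpan Z (μ • p)) + 1 = n := by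
      have : orthogonalSpan Z (μ • p) = orthogonalSpan Z p := by
        simp [orthogonalSpan, smul_dotProduct, hμ0]
      rwa [this]
    have hsign := dotProduct_eq_sign_of_facet hβ hX hq0 hrq (i₀ := i) (by
      rw [smul_dotProduct, smul_eq_mul, hμ, inv_mul_cancel₀ hi])
    have hq : (2 : ℝ) • faceCenter Z (μ • p) ∈ Submodule.span ℤ (Set.range t) := by
      rw [hmem]
      intro j
      rw [← mulVec_eq_two_smul_faceCenter hβ hsign, metricMatrix_mulVec_mulVec hβ hspan, ← hf j,
        dotProduct_comm]
      dsimp only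
      rw [hsign]
      exact ⟨(SignType.sign ((μ • p) ⬝ᵥ Z.col (f j)) : ℤ), by simp⟩
    rw [faceCenter_smul] at hq
    rcases lt_or_gt_of_ne hμ0 with h | h
    · rw [sign_neg h, SignType.coe_neg_one, neg_one_smul, smul_neg] at hq
      exact neg_mem_iff.1 hq
    · rwa [sign_pos h, SignType.coe_one, one_smul] at hq
  · rw [Submodule.span_le]
    rintro _ ⟨j, rfl⟩
    refine Submodule.subset_span (mem_translationVectors_zonotope_iff.2 ?_)
    -- The `j`-th dual vector of `b` is a normalized facet normal, since it is orthogonal to the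
    -- other `n - 1` basis vectors; its translation vector is `t j`.
    obtain ⟨p, hp⟩ := exists_dotProduct_eq_repr b j
    have hpb : ∀ l, p ⬝ᵥ b l = if l = j then 1 else 0 := fun l => by
      rw [hp, Module.Basis.repr_self, Finsupp.single_apply]
    have hp0 : p ≠ 0 := by
      rintro rfl
      simpa using hpb j
    let b' := b.isUnitSMul (w := fun l => (β (f l))⁻¹) fun l =>
      isUnit_iff_ne_zero.2 (inv_ne_zero (hβ _).ne')
    have hb' : ∀ l, b' l = Z.col (f l) := by
      intro l
      rw [Module.Basis.isUnitSMul_apply, ← hf l]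
      dsimp only
      rw [smul_smul, inv_mul_cancel₀ (hβ _).ne', one_smul]
    have hr := finrank_orthogonalSpan_of_basis (Z := Z) hp0 b' (fun l => ⟨f l, (hb' l).symm⟩) j
      fun l hl => by rw [Module.Basis.isUnitSMul_apply, dotProduct_smul, hpb]; simp [hl]
    refine ⟨p, hp0, hr, ?_⟩
    have hsign := dotProduct_eq_sign_of_facet hβ hX hp0 hr (i₀ := f j) (by
      have := hf j
      dsimp only at this
      rw [this, hpb, if_pos rfl])
    rw [← mulVec_eq_two_smul_faceCenter hβ hsign]
    apply t.repr.injective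
    ext l
    rw [Module.Basis.repr_self, Finsupp.single_apply, ht, metricMatrix_mulVec_mulVec hβ hspan,
      dotProduct_comm, hpb]
    simp [eq_comm]
  · rw [hmem]
    constructor
    · rintro h _ ⟨i, rfl⟩
      choose m hm using h
      choose k hk using isUnimodularSystem_iff.1 hX b (fun l => ⟨f l, hf l⟩) _ ⟨i, rfl⟩
      refine ⟨∑ l, k l * m l, ?_⟩
      rw [dotProduct_dicingVector, ← b.sum_repr (β i • Z.col i), dotProduct_sum]
      push_cast
      exact Finset.sum_congr rfl fun l _ => by
        rw [dotProduct_smul, smul_eq_mul, dotProduct_comm, hm, ← hk]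
    · intro h j
      obtain ⟨m, hm⟩ := h _ ⟨f j, rfl⟩
      refine ⟨m, ?_⟩
      rw [dotProduct_dicingVector, dotProduct_comm] at hm
      rw [← hm, ← hf j]

end MetricForm

theorem mainTheorem4 {n r : ℕ} (Z : Matrix (Fin n) (Fin r) ℝ)
    (hP : IsParallelotope (zonotope Z)) :
    (∃ β : Fin r → ℝ, (∀ i, 0 < β i) ∧
      IsUnimodularSystem (Set.range fun i => β i • Z.col i)) ∧
    ∀ β : Fin r → ℝ, (∀ i, 0 < β i) →
      IsUnimodularSystem (Set.range fun i => β i • Z.col i) →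
      (metricMatrix Z β).PosDef ∧
      IsUnimodularSystem (Set.range (dicingVector Z β)) ∧
      DiscreteTopology (translationLattice (zonotope Z)) ∧
      Submodule.span ℝ (translationLattice (zonotope Z) : Set (Fin n → ℝ)) = ⊤ ∧
      (translationLattice (zonotope Z) : Set (Fin n → ℝ)) =
        dicingPoints (Set.range (dicingVector Z β)) ∧
      ∀ x : Fin n → ℝ,
        x ⬝ᵥ (metricMatrix Z β *ᵥ x) = ∑ i, (2 / β i) * (dicingVector Z β i ⬝ᵥ x) ^ 2 := by
  have hspan := span_range_col_eq_top hP.2.1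
  refine ⟨exists_isUnimodularSystem_of_hasBinaryMinors hspan hP.hasBinaryMinors,
    fun β hβ hX => ?_⟩
  have hD : IsUnimodularSystem (Set.range (dicingVector Z β)) := by
    rw [range_dicingVector hβ hspan]
    exact hX.image _
  obtain ⟨t, ht, hmem⟩ := exists_basis_translationLattice hβ hspan hX
  refine ⟨(posDef_scaledMatrix_mul_transpose hβ hspan).inv, hD, ?_, ?_, ?_, fun x => ?_⟩
  · rw [ht]
    infer_instance
  · rw [ht, eq_top_iff, ← t.span_eq]
    exact Submodule.span_mono Submodule.subset_span
  · rw [ht, dicingPoints_eq hD (span_range_dicingVector hβ hspan)]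
    exact Set.ext hmem
  -- At `p = Q x` the form `p · Z_β Z_βᵀ p` equals `Q x · x`.
  · have h := dotProduct_scaledMatrix_mul_transpose_mulVec (Z := Z) hβ (metricMatrix Z β *ᵥ x)
    rw [mulVec_metricMatrix_mulVec hβ hspan] at h
    rw [dotProduct_comm, h]
    exact Finset.sum_congr rfl fun i _ => by
      rw [dotProduct_comm (dicingVector Z β i), dotProduct_dicingVector]
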